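/- Let $k$ be a field, $d,n\ge 1$ integers, and $\underline\ell=(\ell_0,\dots,\ell_{n-1})$ a Kupisch series: positive integers with $\ell_i\ge 2$ for $i\ne 0$ and $\ell_{i+1}\le \ell_i+1$ for all $i$ (indices modulo $n$). *The algebras.* Let $A^{(d)}$ be the incidence $k$-category of $\mathbb Z^d$ with the product order, and let $\mathbf{os}^{(d)}=\{\mu\in\mathbb Z^d:\mu_1\ge\dots\ge\mu_d\}$. Put $$\mathbf{os}^{(d)}_{\underline\ell}=\{\mu\in\mathbf{os}^{(d)}: n-1\ge\mu_1,\ \mu_d\ge 0,\ \mu_1-\mu_d+1\le\ell_{\mu_1}\},\qquad \mathbf{os}^{(d)}_{\tilde{\underline\ell}}=\{\mu\in\mathbf{os}^{(d)}:\mu_1-\mu_d+1\le\tilde\ell_{\mu_1}\},$$ where $\tilde\ell$ is the $n$-periodic extension of $\underline\ell$ to $\mathbb Z$. The higher Nakayama algebra $A^{(d)}_{\underline\ell}$ is the idempotent quotient of $A^{(d)}$ by the objects outside $\mathbf{os}^{(d)}_{\underline\ell}$, and $\tilde A^{(d)}_{\underline\ell}$ is the idempotent quotient of the orbit category of $A^{(d)}$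 under translation by $(n,\dots,n)$ by the objects outside (the image of) $\mathbf{os}^{(d)}_{\tilde{\underline\ell}}$; for $d=1$ one divides out in addition the paths from $i-\tilde\ell_i$ to $i$, so that one obtains the Nakayama algebras with Kupisch series $\underline\ell$. Modules are finite dimensional, and the projective at a vertex $y$ is spanned by the morphisms ending at $y$. *The subcategories.* For $\lambda\in\mathbf{os}^{(d+1)}_{\underline\ell}$ (respectively $\lambda\in\mathbf{os}^{(d+1)}_{\tilde{\underline\ell}}$) let $M_\lambda$ be the interval module: it has a copy of $k$ at each vertex of the interval $[(\lambda_2,\dots,\lambda_{d+1}),(\lambda_1,\dots,\lambda_d)]$, identity maps between these copies and $0$ elsewhere (respectively the push-down of this module to the orbit category). Let $\mathcal M$ (respectively $\tilde{\mathcal M}$) be the $d$-cluster-tilting subcategory formed by the direct summands of finite direct sums of interval modules. *The $\mathrm{Ext}^d$-quiver.* A non-zero object $S$ of an additive category is Schur simple if every non-zero morphism $X\to S$ is an epimorphism and every non-zero morphism $S\to Y$ is a monomorphism. The $\mathrm{Ext}^d$-quiver of a full subcategory of an abelian $k$-category has as vertices the isomorphism classes of Schur simple objects of the subcategory, and $\dim_k\mathrm{Ext}^d(S,S')$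 arrows $[S]\to[S']$, where $\mathrm{Ext}^d$ is taken in the abelian category. **Proposition.** If $\ell_0=1$, then the $\mathrm{Ext}^d$-quiver of $\mathcal M\subseteq\operatorname{mod}A^{(d)}_{\underline\ell}$ is isomorphic to the linearly oriented quiver $\mathbb A_n\colon 0\to1\to\cdots\to n-1$. If $\ell_0\ne1$, then the $\mathrm{Ext}^d$-quiver of $\tilde{\mathcal M}\subseteq\operatorname{mod}\tilde A^{(d)}_{\underline\ell}$ is isomorphic to the cyclically oriented quiver $\tilde{\mathbb A}_{n-1}\colon 0\to1\to\cdots\to n-1\to0$ (a single loop if $n=1$). -/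

import Mathlib

open CategoryTheory CategoryTheory.Limits

universe u v w

namespace HigherNakayama

noncomputable section

/-! ### Finite dimensional modules over a `k`-algebra -/

section FiniteDimensionalModules

open scoped ModuleCat

variable (k : Type u) [Field k] (A : Type u) [Ring A] [Algebra k A]

/-- The property of a left `A`-module of being finite dimensional over `k`. -/
def isFinDim : ObjectProperty (ModuleCat.{u} A) := fun M => Module.Finite k M

/-- The category `mod A` of finite dimensional left `A`-modules. -/
abbrev FinMod := (isFinDim k A).FullSubcategory

instance : (isFinDim k A).IsClosedUnderSubobjects where
  prop_of_mono {X Y} f _ hY := by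
    have hY' : Module.Finite k Y := hY
    exact Module.Finite.of_injective (f.hom.restrictScalars k)
      ((ModuleCat.mono_iff_injective f).1 inferInstance)

instance : (isFinDim k A).IsClosedUnderQuotients where
  prop_of_epi {X Y} f _ hX := by
    have hX' : Module.Finite k X := hX
    exact Module.Finite.of_surjective (f.hom.restrictScalars k)
      ((ModuleCat.epi_iff_surjective f).1 inferInstance)

instance : (isFinDim k A).ContainsZero where
  exists_zero := ⟨ModuleCat.of A PUnit, ModuleCat.isZero_of_subsingleton _, by
    have : Finite (ModuleCat.of A PUnit.{u + 1}) := inferInstanceAs (Finite PUnit)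
    exact (Module.Finite.of_finite : Module.Finite k (ModuleCat.of A PUnit.{u + 1}))⟩

instance : (isFinDim k A).IsClosedUnderFiniteProducts := by
  have : (isFinDim k A).IsClosedUnderBinaryProducts := by
    refine ObjectProperty.IsClosedUnderLimitsOfShape.mk' ?_
    rintro _ ⟨F, hF⟩
    have h1 : Module.Finite k (F.obj ⟨.left⟩) := hF _
    have h2 : Module.Finite k (F.obj ⟨.right⟩) := hF _
    let p := LinearMap.prod ((limit.π F ⟨.left⟩).hom.restrictScalars k)
      ((limit.π F ⟨.right⟩).hom.restrictScalars k)
    refine Module.Finite.of_injective p ?_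
    intro x y hxy
    have e1 : limit.π F ⟨.left⟩ x = limit.π F ⟨.left⟩ y := congrArg Prod.fst hxy
    have e2 : limit.π F ⟨.right⟩ x = limit.π F ⟨.right⟩ y := congrArg Prod.snd hxy
    exact Concrete.limit_ext F x y (by rintro ⟨_ | _⟩ <;> assumption)
  exact ObjectProperty.IsClosedUnderFiniteProducts.mk'

theorem isFinDim_of_surjective (M : ModuleCat.{u} A) {V : Type u} [AddCommGroup V] [Module k V]
    [Module.Finite k V] (e : V →+ M) (he : ∀ (c : k) (v : V), e (c • v) = algebraMap k A c • e v)
    (hs : Function.Surjective e) : isFinDim k A M := by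
  let e' : V →ₗ[k] M := { e with map_smul' := he }
  exact Module.Finite.of_surjective e' hs

end FiniteDimensionalModules

/-! ### Schur simples and the `Ext^d`-quiver -/

/-- A non-zero object `S` is Schur simple if every non-zero morphism to `S` is an epimorphism
and every non-zero morphism from `S` is a monomorphism. -/
def IsSchurSimple {C : Type v} [Category.{w} C] [Preadditive C] : ObjectProperty C := fun S =>
  ¬ IsZero S ∧ (∀ ⦃X : C⦄ (f : X ⟶ S), f ≠ 0 → Epi f) ∧ (∀ ⦃Y : C⦄ (f : S ⟶ Y), f ≠ 0 → Mono f)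

/-- The additive hull of a family of objects: the direct summands of finite direct sums of
members of the family. -/
def addHull {C : Type v} [Category.{w} C] [Abelian C] {ι : Type*} (F : ι → C) :
    ObjectProperty C := fun X =>
  haveI := Abelian.hasFiniteBiproducts (C := C)
  ∃ (m : ℕ) (σ : Fin m → ι), Nonempty (Retract X (⨁ fun i => F (σ i)))

section ExtQuiver

variable (k : Type u) [Field k] {C : Type v} [Category.{w} C] [Abelian C] [Linear k C]

/-- The dimension of `Ext^d(X, Y)`, as a cardinal. -/
def extDim (d : ℕ) (X Y : C) : Cardinal :=
  letI : HasExt.{max v w} C := HasExt.standard C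
  Module.rank k (Abelian.Ext X Y d)

/-- The vertices of the `Ext^d`-quiver of a full subcategory `M`: the isomorphism classes of
Schur simple objects of the category `M`. -/
def ExtQuiver (_k : Type u) (_d : ℕ) (M : ObjectProperty C) : Type _ :=
  Quotient (isIsomorphicSetoid (IsSchurSimple (C := M.FullSubcategory)).FullSubcategory)

/-- An object of the ambient abelian category in the given isomorphism class. -/
def ExtQuiver.rep {d : ℕ} {M : ObjectProperty C} (x : ExtQuiver k d M) : C :=
  (Quotient.out x).obj.obj

/-- The arrows `[S] → [S']` form a set of cardinality `dim_k Ext^d(S, S')`. -/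
instance (d : ℕ) (M : ObjectProperty C) : Quiver (ExtQuiver k d M) where
  Hom x y := (extDim k d x.rep y.rep).out

end ExtQuiver

/-- An isomorphism of quivers. -/
structure QuiverIso (V : Type*) (W : Type*) [Quiver V] [Quiver W] where
  /-- the bijection on vertices -/
  obj : V ≃ W
  /-- the bijections on arrows -/
  hom : ∀ a b : V, (a ⟶ b) ≃ (obj a ⟶ obj b)

/-- The linearly oriented quiver `0 → 1 → ⋯ → n - 1`. -/
def LinearQuiver (n : ℕ) : Type := Fin n

instance (n : ℕ) : Quiver (LinearQuiver n) where
  Hom i j := PLift ((i : Fin n).val + 1 = (j : Fin n).val)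

/-- The cyclically oriented quiver `0 → 1 → ⋯ → n - 1 → 0`; a loop if `n = 1`. -/
def CyclicQuiver (n : ℕ) : Type := Fin n

instance (n : ℕ) : Quiver (CyclicQuiver n) where
  Hom i j := PLift (((i : Fin n).val + 1) % n = (j : Fin n).val)

/-! ### The algebras -/

section Algebras

variable (k : Type u) [Field k] (d : ℕ)

/-- The incidence algebra of `ℤ^d` with the product order consists of the (possibly infinite)
linear combinations of the morphisms `x → y`, one for each pair `x ≤ y`, of the incidence category.
Products are written in the order in which paths are traversed, so that left modules are the
contravariant representations, and the projective at a vertex `y` is spanned by the morphisms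
ending at `y`. The elements invariant under translation by `(s, …, s)` form a subalgebra. Such an
element is determined by its values on the pairs `(x, y)` up to simultaneous translation, that is,
on the morphisms of the orbit category. For `s = 0` every element is invariant. -/
def orbitAlgebra (s : ℤ) : Subalgebra k (IncidenceAlgebra k (Fin d → ℤ)) where
  carrier := {f | ∀ x y : Fin d → ℤ, f (fun i => x i + s) (fun i => y i + s) = f x y}
  mul_mem' {f g} hf hg := by
    intro x y
    simp only [Set.mem_ofPred_eq] at hf hg
    simp only [IncidenceAlgebra.mul_apply]
    refine Finset.sum_nbij' (fun z i => z i - s) (fun z i => z i + s) ?_ ?_ ?_ ?_ ?_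
    · intro z hz
      simp only [Finset.mem_Icc, Pi.le_def] at hz ⊢
      exact ⟨fun i => by linarith [hz.1 i], fun i => by linarith [hz.2 i]⟩
    · intro z hz
      simp only [Finset.mem_Icc, Pi.le_def] at hz ⊢
      exact ⟨fun i => by linarith [hz.1 i], fun i => by linarith [hz.2 i]⟩
    · intro z _; ext i; simp
    · intro z _; ext i; simp
    · intro z _
      rw [← hf x, ← hg _ y]
      simp
  add_mem' {f g} hf hg := by
    intro x y
    simp only [Set.mem_ofPred_eq] at hf hg
    simp [IncidenceAlgebra.add_apply, hf x y, hg x y]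
  algebraMap_mem' c := by
    intro x y
    have h : ((fun i => x i + s) = fun i => y i + s) ↔ x = y := by
      simp [funext_iff]
    simp [Algebra.algebraMap_eq_smul_one, IncidenceAlgebra.constSMul_apply, h]

/-- The elements to be divided out: the linear combinations of identities of vertices outside the
set `U` and, for `d = 1` only, the linear combinations of the paths `i - ℓ i ⇝ i`. -/
def relations (s : ℤ) (U : Set (Fin d → ℤ)) (ℓ : ℤ → ℕ) : Set (orbitAlgebra k d s) :=
  {f | ∀ x y, f.1 x y ≠ 0 → x = y ∧ x ∉ U} ∪
  {f | d = 1 ∧ ∀ x y, f.1 x y ≠ 0 → ∀ i, x i = y i - ℓ (y i)}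

/-- The idempotent quotient, at the vertices outside `U`, of the incidence category of `ℤ^d` modulo
translation by `(s, …, s)`; for `d = 1` also modulo the paths `i - ℓ i ⇝ i`. Below, `U` has only
finitely many vertices up to translation, and the quotient is then the finite dimensional algebra
spanned by the (classes of) morphisms `x → y` with `[x, y] ⊆ U` (and `y - x < ℓ y` if `d = 1`). -/
abbrev QuotientAlgebra (s : ℤ) (U : Set (Fin d → ℤ)) (ℓ : ℤ → ℕ) : Type u :=
  (TwoSidedIdeal.span (relations k d s U ℓ)).ringCon.Quotient

variable {d}

/-- The operator `(f • v) x = ∑ y ∈ [a, b], f x y * v y` as a matrix. -/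
def intervalMatrix (a b : Fin d → ℤ) (f : IncidenceAlgebra k (Fin d → ℤ)) :
    Matrix (Set.Icc a b) (Set.Icc a b) k :=
  Matrix.of fun x y => f x.1 y.1

theorem intervalMatrix_mul (a b : Fin d → ℤ) (f g : IncidenceAlgebra k (Fin d → ℤ)) :
    intervalMatrix k a b (f * g) = intervalMatrix k a b f * intervalMatrix k a b g := by
  classical
  ext x z
  simp only [intervalMatrix, Matrix.of_apply, IncidenceAlgebra.mul_apply, Matrix.mul_apply]
  symm
  rw [← Finset.sum_subset (Finset.subset_univ
    (Finset.univ.filter fun y : Set.Icc a b => x.1 ≤ y.1 ∧ y.1 ≤ z.1))]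
  · refine Finset.sum_bij (fun y _ => y.1) ?_ ?_ ?_ ?_
    · intro y hy
      simpa using hy
    · intro y _ y' _ h
      exact Subtype.ext h
    · intro y hy
      rw [Finset.mem_Icc] at hy
      exact ⟨⟨y, x.2.1.trans hy.1, hy.2.trans z.2.2⟩, Finset.mem_filter.2 ⟨Finset.mem_univ _, hy⟩, rfl⟩
    · intro y _
      rfl
  · intro y _ hy
    simp only [Finset.mem_filter, Finset.mem_univ, true_and, not_and_or] at hy
    rcases hy with hy | hy
    · rw [IncidenceAlgebra.apply_eq_zero_of_not_le hy, zero_mul]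
    · rw [IncidenceAlgebra.apply_eq_zero_of_not_le hy, mul_zero]

/-- The representation of the incidence algebra on the functions on the interval `[a, b]`. -/
def incidenceAction (a b : Fin d → ℤ) :
    IncidenceAlgebra k (Fin d → ℤ) →ₐ[k] Matrix (Set.Icc a b) (Set.Icc a b) k :=
  AlgHom.ofLinearMap
    { toFun := intervalMatrix k a b
      map_add' := fun f g => by ext x y; simp [intervalMatrix]
      map_smul' := fun c f => by
        ext x y; simp [intervalMatrix, IncidenceAlgebra.constSMul_apply] }
    (by ext x y; simp [intervalMatrix, Matrix.one_apply, Subtype.ext_iff])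
    (intervalMatrix_mul k a b)

/-- The vector space with one basis vector for each vertex of the interval `[a, b]`. -/
def IntervalSpace (a b : Fin d → ℤ) : Type u := Set.Icc a b → k

instance (a b : Fin d → ℤ) : AddCommGroup (IntervalSpace k a b) :=
  inferInstanceAs (AddCommGroup (Set.Icc a b → k))

instance (a b : Fin d → ℤ) : Module k (IntervalSpace k a b) :=
  inferInstanceAs (Module k (Set.Icc a b → k))

instance (a b : Fin d → ℤ) : Module.Finite k (IntervalSpace k a b) :=
  inferInstanceAs (Module.Finite k (Set.Icc a b → k))

variable {k}

/-- The interval `[a, b]` supports a module over the quotient algebra: the relations act as zero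
on the functions on `[a, b]`. -/
def IsAdmissibleInterval (k : Type u) [Field k] (s : ℤ) (U : Set (Fin d → ℤ)) (ℓ : ℤ → ℕ)
    (a b : Fin d → ℤ) : Prop :=
  ∀ f ∈ relations k d s U ℓ, ∀ x ∈ Set.Icc a b, ∀ y ∈ Set.Icc a b, f.1 x y = 0

variable {s : ℤ} {U : Set (Fin d → ℤ)} {ℓ : ℤ → ℕ} {a b : Fin d → ℤ}

/-- The action of the quotient algebra on the functions on `[a, b]`. -/
def intervalAction (h : IsAdmissibleInterval k s U ℓ a b) :
    QuotientAlgebra k d s U ℓ →ₐ[k] Module.End k (IntervalSpace k a b) :=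
  (Matrix.toLinAlgEquiv' (R := k) (n := Set.Icc a b)).toAlgHom.comp
    (RingCon.liftₐ _ ((incidenceAction k a b).comp (orbitAlgebra k d s).val) (by
      have hle : TwoSidedIdeal.span (relations k d s U ℓ) ≤
          ⟨RingCon.ker ((incidenceAction k a b).comp (orbitAlgebra k d s).val).toRingHom⟩ := by
        rw [TwoSidedIdeal.span_le]
        intro f hf
        change intervalMatrix k a b f.1 = intervalMatrix k a b 0
        ext x y
        exact h f hf x.1 x.2 y.1 y.2
      exact TwoSidedIdeal.ringCon_le_iff.1 hle))

/-- The resulting module structure. -/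
@[reducible] def intervalModuleStructure (h : IsAdmissibleInterval k s U ℓ a b) :
    Module (QuotientAlgebra k d s U ℓ) (IntervalSpace k a b) :=
  Module.compHom _ (intervalAction h).toRingHom

theorem interval_isFinDim (h : IsAdmissibleInterval k s U ℓ a b) :
    letI := intervalModuleStructure h
    isFinDim k _ (ModuleCat.of (QuotientAlgebra k d s U ℓ) (IntervalSpace k a b)) := by
  let _ := intervalModuleStructure h
  refine isFinDim_of_surjective k _
    (ModuleCat.of (QuotientAlgebra k d s U ℓ) (IntervalSpace k a b))
    (V := IntervalSpace k a b) (AddMonoidHom.id _) (fun c v => ?_) fun v => ⟨v, rfl⟩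
  change c • v = intervalAction h (algebraMap k _ c) v
  rw [AlgHom.commutes]
  rfl

/-- The functions on `[a, b]` as a finite dimensional module over the quotient algebra. For
`s ≠ 0` it is the push-down, to the orbit category, of the representation with a copy of `k` on
each vertex of `[a, b]`, identities between them, and `0` elsewhere. -/
def intervalModule (h : IsAdmissibleInterval k s U ℓ a b) :
    FinMod k (QuotientAlgebra k d s U ℓ) where
  obj :=
    letI := intervalModuleStructure h
    ModuleCat.of (QuotientAlgebra k d s U ℓ) (IntervalSpace k a b)
  property := interval_isFinDim h

end Algebras

/-! ### Kupisch series and higher Nakayama algebras -/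

section Nakayama

/-- Kupisch series of connected Nakayama algebras, given as admissible quotients of the path
algebra of the linear quiver (`ℓ 0 = 1`) or of the cyclic quiver (`ℓ 0 ≠ 1`): the dimensions of
the indecomposable projectives `P_0, …, P_{n-1}`. In `step`, the index `i + 1` is taken modulo
`n`. -/
structure IsKupisch {n : ℕ} [NeZero n] (ℓ : Fin n → ℕ) : Prop where
  pos : 1 ≤ ℓ 0
  two_le : ∀ i, i ≠ 0 → 2 ≤ ℓ i
  step : ∀ i, ℓ (i + 1) ≤ ℓ i + 1

variable {n : ℕ} [NeZero n]

/-- The `n`-periodic extension of `ℓ` to `ℤ`. -/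
def periodicExt (ℓ : Fin n → ℕ) (i : ℤ) : ℕ :=
  ℓ ⟨(i % n).toNat, by
    have hn : (0 : ℤ) < n := by exact_mod_cast Nat.pos_of_ne_zero (NeZero.ne n)
    have h1 := Int.emod_nonneg i hn.ne'
    have h2 := Int.emod_lt_of_pos i hn
    omega⟩

/-- Weakly decreasing integer sequences `μ_1 ≥ ⋯ ≥ μ_d`. -/
def os (d : ℕ) : Set (Fin d → ℤ) := {μ | Antitone μ}

/-- The sequences `n - 1 ≥ μ_1 ≥ ⋯ ≥ μ_d ≥ 0` with `μ_1 - μ_d + 1 ≤ ℓ_{μ_1}`. -/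
def osLin (d : ℕ) [NeZero d] (ℓ : Fin n → ℕ) : Set (Fin d → ℤ) :=
  {μ | μ ∈ os d ∧ μ 0 ≤ n - 1 ∧ 0 ≤ μ ⊤ ∧ μ 0 - μ ⊤ + 1 ≤ periodicExt ℓ (μ 0)}

/-- The sequences `μ_1 ≥ ⋯ ≥ μ_d` with `μ_1 - μ_d + 1 ≤ ℓ_{μ_1}`, `ℓ` extended periodically. -/
def osCyc (d : ℕ) [NeZero d] (ℓ : Fin n → ℕ) : Set (Fin d → ℤ) :=
  {μ | μ ∈ os d ∧ μ 0 - μ ⊤ + 1 ≤ periodicExt ℓ (μ 0)}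

variable (k : Type u) [Field k] (d : ℕ) [NeZero d]

/-- The higher Nakayama algebra `A_ℓ^{(d)}` of type `𝔸_n`. (Intervals of `ℤ^d` with end
points in the box `[0, n - 1]^d` stay in the box, so one may divide out the vertices outside
the box instead of passing to a full subcategory.) -/
abbrev linAlgebra (ℓ : Fin n → ℕ) : Type u :=
  QuotientAlgebra k d 0 (osLin d ℓ) (periodicExt ℓ)

/-- The higher Nakayama algebra of type `𝔸̃_{n-1}`. -/
abbrev cycAlgebra (ℓ : Fin n → ℕ) : Type u :=
  QuotientAlgebra k d n (osCyc d ℓ) (periodicExt ℓ)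

theorem periodicExt_succ_le {ℓ : Fin n → ℕ} (hℓ : IsKupisch ℓ) (i : ℤ) :
    periodicExt ℓ (i + 1) ≤ periodicExt ℓ i + 1 := by
  have hn : (0 : ℤ) < n := by exact_mod_cast Nat.pos_of_ne_zero (NeZero.ne n)
  have h1 := Int.emod_nonneg i hn.ne'
  have h2 := Int.emod_lt_of_pos i hn
  refine le_trans (le_of_eq ?_) (hℓ.step ⟨(i % n).toNat, by omega⟩)
  unfold periodicExt
  congr 1
  apply Fin.ext
  rw [Fin.val_add, Fin.val_one', Nat.add_mod_mod]
  zify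
  rw [Int.toNat_of_nonneg (Int.emod_nonneg _ hn.ne'), Int.toNat_of_nonneg h1, Int.emod_add_emod]

theorem sub_periodicExt_mono {ℓ : Fin n → ℕ} (hℓ : IsKupisch ℓ) :
    Monotone fun i : ℤ => i - periodicExt ℓ i :=
  monotone_int_of_le_succ fun i => by
    have := periodicExt_succ_le hℓ i
    omega

theorem isAdmissibleInterval {ℓ : Fin n → ℕ} (hℓ : IsKupisch ℓ) (s : ℤ) (U : Set (Fin d → ℤ))
    (l : Fin (d + 1) → ℤ) (hl : l 0 - l ⊤ + 1 ≤ periodicExt ℓ (l 0))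
    (hU : Set.Icc (Fin.tail l) (Fin.init l) ⊆ U) :
    IsAdmissibleInterval k s U (periodicExt ℓ) (Fin.tail l) (Fin.init l) := by
  intro f hf x hx y hy
  by_contra h
  rcases hf with hf | ⟨hd, hf⟩
  · exact (hf x y h).2 (hU hx)
  · have h1 := hf x y h 0
    have h2 := hx.1 0
    have h3 := hy.2 0
    subst hd
    have h4 := sub_periodicExt_mono hℓ h3
    have h5 : Fin.init l 0 = l 0 := rfl
    have h6 : Fin.tail l 0 = l ⊤ := rfl
    simp only [h5, h6] at h4 h2
    omega

theorem mem_os_of_mem_interval {l : Fin (d + 1) → ℤ} {x : Fin d → ℤ}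
    (hx : x ∈ Set.Icc (Fin.tail l) (Fin.init l)) : x ∈ os d := by
  cases d with
  | zero => exact absurd rfl (NeZero.ne 0)
  | succ d =>
    refine Fin.antitone_iff_succ_le.2 fun i => ?_
    exact (hx.2 i.succ).trans (hx.1 i.castSucc)

theorem interval_bounds {ℓ : Fin n → ℕ} (hℓ : IsKupisch ℓ)
    {l : Fin (d + 1) → ℤ} (hl : l 0 - l ⊤ + 1 ≤ periodicExt ℓ (l 0)) {x : Fin d → ℤ}
    (hx : x ∈ Set.Icc (Fin.tail l) (Fin.init l)) :
    x 0 ≤ l 0 ∧ l ⊤ ≤ x ⊤ ∧ x 0 - x ⊤ + 1 ≤ periodicExt ℓ (x 0) := by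
  cases d with
  | zero => exact absurd rfl (NeZero.ne 0)
  | succ d =>
    have h1 : x 0 ≤ l 0 := hx.2 0
    have h2 : l ⊤ ≤ x ⊤ := hx.1 (Fin.last d)
    have h3 := sub_periodicExt_mono hℓ h1
    simp only at h3
    exact ⟨h1, h2, by omega⟩

variable {d}

/-- The interval module `M_λ` over `A_ℓ^{(d)}`, supported on the interval
`[(λ_2, …, λ_{d+1}), (λ_1, …, λ_d)]`. -/
def linIntervalModule {ℓ : Fin n → ℕ} (hℓ : IsKupisch ℓ) (l : osLin (d + 1) ℓ) :
    FinMod k (linAlgebra k d ℓ) :=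
  intervalModule (isAdmissibleInterval k d hℓ 0 (osLin d ℓ) l.1 l.2.2.2.2 fun x hx => by
    have h := interval_bounds d hℓ l.2.2.2.2 hx
    exact ⟨mem_os_of_mem_interval d hx, h.1.trans l.2.2.1, l.2.2.2.1.trans h.2.1, h.2.2⟩)

/-- The interval module `M_λ` over the algebra of type `𝔸̃_{n-1}`. -/
def cycIntervalModule {ℓ : Fin n → ℕ} (hℓ : IsKupisch ℓ) (l : osCyc (d + 1) ℓ) :
    FinMod k (cycAlgebra k d ℓ) :=
  intervalModule (isAdmissibleInterval k d hℓ n (osCyc d ℓ) l.1 l.2.2 fun _ hx =>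
    ⟨mem_os_of_mem_interval d hx, (interval_bounds d hℓ l.2.2 hx).2.2⟩)

variable (d)

/-- The `d`-cluster-tilting subcategory of `mod A_ℓ^{(d)}`: the additive hull of the interval
modules. -/
def linClusterTilting {ℓ : Fin n → ℕ} (hℓ : IsKupisch ℓ) :
    ObjectProperty (FinMod k (linAlgebra k d ℓ)) :=
  addHull (linIntervalModule k (d := d) hℓ)

/-- The `d`-cluster-tilting subcategory in type `𝔸̃_{n-1}`: the additive hull of the interval
modules. -/
def cycClusterTilting {ℓ : Fin n → ℕ} (hℓ : IsKupisch ℓ) :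
    ObjectProperty (FinMod k (cycAlgebra k d ℓ)) :=
  addHull (cycIntervalModule k (d := d) hℓ)

end Nakayama

end

end HigherNakayama

/-! Write `S_i` for the interval module on the single vertex `(i, …, i)`. The proof shows that the
`S_i`, up to translation, are the Schur simple objects, and that `Ext^d(S_i, S_j)` is
one-dimensional if `ℓ_i ≥ 2` and `j` is a translate of `i - 1`, and zero otherwise. Both types are
treated together: translation is by `s = 0` in the linear case and by `s = n` in the cyclic one.

Schur simples: if `X` is Schur simple in the additive hull, some component `X ⟶ M_λ ⟶ X` of the
identity is non-zero, hence mono, hence split by finite-dimensionality of `End X`; so `X` is a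
summand of one `M_λ` (`exists_retract_of_isSchurSimple`). Let `[a, b]` be the interval of `λ`.
Shifting the entries of `λ` gives interval modules in the subcategory with top `a` and with socle
`b`. They induce non-zero maps into and out of `X`, whose composite vanishes if `a ≠ b`; this is
impossible for a Schur simple object (`eq_of_isSchurSimple_retract`). If `a = b`, then `λ` is
constant.

Extensions: let `ℓ_i ≥ 2` and `m = i - ℓ_i + 1`. For `0 ≤ j < d` the interval module `P_j` of `(i,
…, i, i - 1, …, i - 1, m)`, with `j` entries `i - 1`, is projective, because every morphism to its
top vertex from outside the interval is zero in the algebra. Cutting its interval in two gives short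
exact sequences `0 → K_{j+1} → P_j → K_j → 0` with `K_0 = S_i`, and `K_d` has top vertex `(i - 1, …,
i - 1)`. Maps from `P_j` to one-vertex modules vanish on `K_{j+1}`, so dimension shifting gives
`Ext^d(S_i, S_c) = Hom(K_d, S_c)` (`extDim_onePoint_of_two_le`). If `ℓ_i = 1`, then `S_i` is
projective (`extDim_onePoint_of_eq_one`). -/

namespace HigherNakayama

noncomputable section

/-! ### Dimensions of `Ext` and recognition of the `Ext^d`-quiver -/

section ExtDim

variable (k : Type u) [Field k] {C : Type v} [Category.{w} C] [Abelian C] [Linear k C]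

theorem extDim_le_of_retract (d : ℕ) {X X' Y Y' : C} (p : X' ⟶ X) (q : X ⟶ X') (hpq : q ≫ p = 𝟙 X)
    (i : Y ⟶ Y') (r : Y' ⟶ Y) (hir : i ≫ r = 𝟙 Y) : extDim k d X Y ≤ extDim k d X' Y' := by
  let _ : HasExt.{max v w} C := HasExt.standard C
  let φ : Abelian.Ext X Y d →ₗ[k] Abelian.Ext X' Y' d :=
    ((Abelian.Ext.mk₀ i).postcompOfLinear k X' (add_zero d)).comp
      ((Abelian.Ext.mk₀ p).precompOfLinear k Y (zero_add d))
  let ψ : Abelian.Ext X' Y' d →ₗ[k] Abelian.Ext X Y d :=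
    ((Abelian.Ext.mk₀ r).postcompOfLinear k X (add_zero d)).comp
      ((Abelian.Ext.mk₀ q).precompOfLinear k Y' (zero_add d))
  refine LinearMap.rank_le_of_injective φ (Function.LeftInverse.injective (g := ψ) fun x => ?_)
  simp only [φ, ψ, LinearMap.comp_apply, Abelian.Ext.bilinearCompOfLinear_apply_apply,
    LinearMap.flip_apply]
  rw [Abelian.Ext.comp_assoc_of_third_deg_zero, Abelian.Ext.comp_assoc_of_third_deg_zero,
    Abelian.Ext.mk₀_comp_mk₀, hir, Abelian.Ext.comp_mk₀_id, Abelian.Ext.mk₀_comp_mk₀_assoc, hpq,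
    Abelian.Ext.mk₀_id_comp]

theorem extDim_congr (d : ℕ) {X X' Y Y' : C} (e : X ≅ X') (f : Y ≅ Y') :
    extDim k d X Y = extDim k d X' Y' :=
  le_antisymm
    (extDim_le_of_retract k d e.inv e.hom e.hom_inv_id f.hom f.inv f.hom_inv_id)
    (extDim_le_of_retract k d e.hom e.inv e.inv_hom_id f.inv f.hom f.inv_hom_id)

theorem extDim_zero_eq (X Y : C) : extDim k 0 X Y = Cardinal.lift.{v} (Module.rank k (X ⟶ Y)) := by
  let _ : HasExt.{max v w} C := HasExt.standard C
  have h := (Abelian.Ext.linearEquiv₀ (R := k) (X := X) (Y := Y)).lift_rank_eq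
  rw [Cardinal.lift_id'.{w, max v w}] at h
  rw [extDim, h]
  exact congrFun Cardinal.lift_umax.{w, v} _

/-- A short exact sequence whose middle term is projective shifts the degree of `Ext`. -/
theorem extDim_succ_of_shortExact {S : ShortComplex C} (hS : S.ShortExact) [Projective S.X₂]
    (Y : C) (m : ℕ) (h : m = 0 → ∀ φ : S.X₂ ⟶ Y, S.f ≫ φ = 0) :
    extDim k (m + 1) S.X₃ Y = extDim k m S.X₁ Y := by
  let _ : HasExt.{max v w} C := HasExt.standard C
  -- The connecting map is injective because nothing non-zero comes from `Ext^m(X₂, Y)`: this is `h`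
  -- for `m = 0` and projectivity for `m > 0`. It is surjective because `Ext^(m+1)(X₂, Y)` vanishes.
  refine (LinearEquiv.rank_eq (LinearEquiv.ofBijective
    (hS.extClass.precompOfLinear k Y (add_comm 1 m)) ⟨?_, fun x => ?_⟩)).symm
  · rw [← LinearMap.ker_eq_bot, Submodule.eq_bot_iff]
    intro x hx
    obtain ⟨y, rfl⟩ := Abelian.Ext.contravariant_sequence_exact₁ hS Y x (add_comm 1 m) hx
    cases m with
    | zero =>
      obtain ⟨φ, rfl⟩ := Abelian.Ext.homEquiv₀.symm.surjective y
      rw [Abelian.Ext.homEquiv₀_symm_apply, Abelian.Ext.mk₀_comp_mk₀, h rfl,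
        Abelian.Ext.mk₀_zero]
    | succ m => rw [Abelian.Ext.eq_zero_of_projective y, Abelian.Ext.comp_zero]
  · exact Abelian.Ext.contravariant_sequence_exact₃ hS Y x
      (Abelian.Ext.eq_zero_of_projective _) (add_comm 1 m)

theorem extDim_succ_eq_zero_of_projective (X Y : C) [Projective X] (m : ℕ) :
    extDim k (m + 1) X Y = 0 := by
  let _ : HasExt.{max v w} C := HasExt.standard C
  have : Subsingleton (Abelian.Ext X Y (m + 1)) :=
    subsingleton_of_forall_eq 0 Abelian.Ext.eq_zero_of_projective
  exact rank_subsingleton' k _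

/-- A complete irredundant family of Schur simple objects, indexed by the vertices of a quiver `W`
with the right numbers of arrows, identifies the `Ext^d`-quiver with `W`. -/
theorem nonempty_quiverIso_of_classification (d : ℕ) (M : ObjectProperty C) {W : Type*} [Quiver W]
    (S : W → M.FullSubcategory) (hS : ∀ a, IsSchurSimple (S a))
    (inj : ∀ a b, Nonempty (S a ≅ S b) → a = b)
    (surj : ∀ X : M.FullSubcategory, IsSchurSimple X → ∃ a, Nonempty (S a ≅ X))
    (arrows : ∀ a b, Nonempty ((extDim k d (S a).obj (S b).obj).out ≃ (a ⟶ b))) :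
    Nonempty (QuiverIso (ExtQuiver k d M) W) := by
  let T : W → (IsSchurSimple (C := M.FullSubcategory)).FullSubcategory := fun a => ⟨S a, hS a⟩
  let F : W → ExtQuiver k d M := fun a => Quotient.mk (isIsomorphicSetoid _) (T a)
  have hF : Function.Bijective F := by
    constructor
    · intro a b hab
      obtain ⟨e⟩ := Quotient.exact hab
      exact inj a b ⟨(ObjectProperty.ι _).mapIso e⟩
    · intro x
      induction x using Quotient.inductionOn with
      | _ X =>
        obtain ⟨a, ⟨e⟩⟩ := surj X.obj X.property
        exact ⟨a, Quotient.sound ⟨ObjectProperty.isoMk _ e⟩⟩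
  -- Arrows are defined through chosen representatives, which are only isomorphic to the given
  -- objects; `extDim_congr` bridges the difference.
  have hrep : ∀ a, Nonempty ((F a).rep ≅ (S a).obj) := fun a => by
    obtain ⟨e⟩ := Quotient.exact (Quotient.out_eq (F a))
    exact ⟨M.ι.mapIso ((ObjectProperty.ι _).mapIso e)⟩
  let E : W ≃ ExtQuiver k d M := Equiv.ofBijective F hF
  have harr : ∀ x y : ExtQuiver k d M, Nonempty ((x ⟶ y) ≃ (E.symm x ⟶ E.symm y)) := fun x y => by
    obtain ⟨a, rfl⟩ := E.surjective x
    obtain ⟨b, rfl⟩ := E.surjective y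
    obtain ⟨ea⟩ := hrep a
    obtain ⟨eb⟩ := hrep b
    rw [E.symm_apply_apply, E.symm_apply_apply]
    have h : extDim k d (E a).rep (E b).rep = extDim k d (S a).obj (S b).obj :=
      extDim_congr k d ea eb
    obtain ⟨e⟩ := arrows a b
    exact ⟨(Equiv.cast (congrArg Quotient.out h)).trans e⟩
  exact ⟨⟨E.symm, fun x y => (harr x y).some⟩⟩

end ExtDim

/-! ### Schur simple objects of an additive hull -/

section AddHull

variable {C : Type v} [Category.{w} C] [Abelian C]

theorem addHull_apply {ι : Type*} (F : ι → C) (i : ι) : addHull F (F i) := by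
  have := Abelian.hasFiniteBiproducts (C := C)
  exact ⟨1, fun _ => i, ⟨⟨biproduct.ι (fun _ : Fin 1 => F i) 0,
    biproduct.π (fun _ : Fin 1 => F i) 0,
    biproduct.ι_π_self _ _⟩⟩⟩

/-- A Schur simple object of the additive hull is a direct summand of a member of the family. -/
theorem exists_retract_of_isSchurSimple (k : Type u) [Field k] [Linear k C]
    [∀ X Y : C, Module.Finite k (X ⟶ Y)] {ι : Type*} (F : ι → C)
    (X : (addHull F).FullSubcategory) (hX : IsSchurSimple X) :
    ∃ i, Nonempty (Retract X.obj (F i)) := by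
  have := Abelian.hasFiniteBiproducts (C := C)
  obtain ⟨m, σ, ⟨ρ⟩⟩ := X.property
  -- The identity of `X` is the sum of its components through the members of the family, so one
  -- component is non-zero.
  have hsum : ∑ j, (ρ.i ≫ biproduct.π (fun i => F (σ i)) j) ≫
      (biproduct.ι (fun i => F (σ i)) j ≫ ρ.r) = 𝟙 X.obj := by
    have h := ρ.retract
    rw [← Category.id_comp ρ.r, ← biproduct.total, Preadditive.sum_comp, Preadditive.comp_sum] at h
    simpa using h
  have hne : ∃ j, (ρ.i ≫ biproduct.π (fun i => F (σ i)) j) ≫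
      (biproduct.ι (fun i => F (σ i)) j ≫ ρ.r) ≠ 0 := by
    by_contra! h
    refine hX.1 ((IsZero.iff_id_eq_zero X).2 ?_)
    ext
    change 𝟙 X.obj = 0
    rw [← hsum]
    exact Finset.sum_eq_zero fun j _ => h j
  obtain ⟨j, hj⟩ := hne
  refine ⟨σ j, ?_⟩
  set e : X.obj ⟶ X.obj := (ρ.i ≫ biproduct.π (fun i => F (σ i)) j) ≫
    (biproduct.ι (fun i => F (σ i)) j ≫ ρ.r) with he
  have hmono : Mono ((addHull F).homMk e : X ⟶ X) := hX.2.2 _ fun h => hj (by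
    have := congrArg InducedCategory.Hom.hom h
    exact this)
  -- Composition with the monomorphism `e` is an injective endomorphism of the finite-dimensional
  -- space `End X`, hence surjective; a preimage of the identity splits `e`.
  have hinj : Function.Injective (Linear.rightComp k X.obj e) := by
    intro φ ψ h
    have := (cancel_mono ((addHull F).homMk e : X ⟶ X)).1
      (show (addHull F).homMk φ ≫ (addHull F).homMk e = (addHull F).homMk ψ ≫ (addHull F).homMk e by
        ext; exact h)
    exact congrArg InducedCategory.Hom.hom this
  obtain ⟨φ, hφ⟩ := LinearMap.injective_iff_surjective.1 hinj (𝟙 X.obj)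
  have hφ' : φ ≫ e = 𝟙 X.obj := hφ
  exact ⟨⟨φ ≫ ρ.i ≫ biproduct.π (fun i => F (σ i)) j, biproduct.ι (fun i => F (σ i)) j ≫ ρ.r, by
    rw [← hφ', he]
    simp only [Category.assoc]⟩⟩

end AddHull

/-! ### Epimorphisms, exactness and Hom-spaces for finite dimensional modules -/

section FinMod

variable {k : Type u} [Field k] {A : Type u} [Ring A] [Algebra k A]

theorem FinMod.surjective_of_epi {X Y : FinMod k A} (f : X ⟶ Y) [Epi f] :
    Function.Surjective f.hom.hom := by
  have := (isFinDim k A).preservesEpimorphisms_ι_of_isNormalMonoCategory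
  exact (ModuleCat.epi_iff_surjective f.hom).1 (inferInstanceAs (Epi ((isFinDim k A).ι.map f)))

theorem FinMod.epi_of_surjective {X Y : FinMod k A} (f : X ⟶ Y)
    (hf : Function.Surjective f.hom.hom) : Epi f := by
  have : Epi ((isFinDim k A).ι.map f) := (ModuleCat.epi_iff_surjective f.hom).2 hf
  exact (isFinDim k A).ι.epi_of_epi_map this

theorem FinMod.mono_of_injective {X Y : FinMod k A} (f : X ⟶ Y)
    (hf : Function.Injective f.hom.hom) : Mono f := by
  have : Mono ((isFinDim k A).ι.map f) := (ModuleCat.mono_iff_injective f.hom).2 hf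
  exact (isFinDim k A).ι.mono_of_mono_map this

theorem FinMod.shortExact {S : ShortComplex (FinMod k A)} (hf : Function.Injective S.f.hom.hom)
    (hg : Function.Surjective S.g.hom.hom)
    (h : ∀ y, S.g.hom.hom y = 0 → ∃ x, S.f.hom.hom x = y) : S.ShortExact := by
  have : (isFinDim k A).ι.PreservesHomology :=
    { preservesKernels := fun _ _ f => (isFinDim k A).preservesKernels_ι f
      preservesCokernels := fun _ _ f => (isFinDim k A).preservesCokernels_ι f }
  have hex : S.Exact := by
    rw [← ShortComplex.exact_map_iff_of_faithful S (isFinDim k A).ι,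
      ShortComplex.moduleCat_exact_iff]
    exact h
  exact { exact := hex, mono_f := FinMod.mono_of_injective _ hf,
          epi_g := FinMod.epi_of_surjective _ hg }

open scoped ModuleCat in
instance (X Y : FinMod k A) : Module.Finite k (X ⟶ Y) := by
  have hX : Module.Finite k X.obj := X.property
  have hY : Module.Finite k Y.obj := Y.property
  let φ : (X ⟶ Y) →ₗ[k] (X.obj →ₗ[k] Y.obj) :=
    { toFun := fun f => f.hom.hom.restrictScalars k
      map_add' := fun f g => rfl
      map_smul' := fun c f => by
        ext x
        rfl }
  refine Module.Finite.of_injective φ fun f g h => ?_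
  ext x
  exact LinearMap.congr_fun h x

/-- Morphisms of finite dimensional modules from linear maps. -/
abbrev FinMod.ofLinearMap {X Y : FinMod k A} (f : X.obj →ₗ[A] Y.obj) : X ⟶ Y :=
  (isFinDim k A).homMk (ModuleCat.ofHom f)

end FinMod

/-! ### Columns: elements of the orbit algebra ending at a fixed vertex -/

open scoped Classical in
/-- The element of the orbit algebra with value `c u` on the morphism `u ⟶ b`, and zero on the
morphisms whose target is not a translate of `b`. -/
def column {k : Type u} [Field k] {d : ℕ} (s : ℤ) (b : Fin d → ℤ) (c : (Fin d → ℤ) → k) :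
    orbitAlgebra k d s where
  val :=
    -- The source is moved by `b - w`, which carries the target to `b`; this makes the element
    -- invariant.
    { toFun := fun u w => if (∃ t : ℤ, w = fun i => b i + t * s) ∧ u ≤ w then
        c (fun i => u i + b i - w i) else 0
      eq_zero_of_not_le' := fun u w h => if_neg fun h' => h h'.2 }
  property := by
    intro x y
    have h1 : (∃ t : ℤ, (fun i => y i + s) = fun i => b i + t * s) ↔
        ∃ t : ℤ, y = fun i => b i + t * s := by
      constructor
      · rintro ⟨t, ht⟩
        exact ⟨t - 1, funext fun i => by linarith [congrFun ht i]⟩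
      · rintro ⟨t, ht⟩
        exact ⟨t + 1, funext fun i => by linarith [congrFun ht i]⟩
    have h2 : ((fun i => x i + s) ≤ fun i => y i + s) ↔ x ≤ y := by
      simp [Pi.le_def]
    have h3 : (fun i => x i + s + b i - (y i + s)) = fun i => x i + b i - y i :=
      funext fun i => by ring
    change (if _ then _ else _) = (if _ then _ else _)
    simp only [h1, h2, h3]

section Column

variable {k : Type u} [Field k] {d : ℕ} {s : ℤ}

theorem column_apply_self (b : Fin d → ℤ) (c : (Fin d → ℤ) → k) {u : Fin d → ℤ} (hu : u ≤ b) :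
    (column s b c).1 u b = c u := by
  have h : ∃ t : ℤ, b = fun i => b i + t * s := ⟨0, by simp⟩
  classical
  change (if _ then _ else _) = _
  rw [if_pos ⟨h, hu⟩]
  congr 1
  ext i
  ring

theorem exists_of_column_apply_ne_zero {b : Fin d → ℤ} {c : (Fin d → ℤ) → k} {u w : Fin d → ℤ}
    (h : (column s b c).1 u w ≠ 0) :
    ∃ t : ℤ, (w = fun i => b i + t * s) ∧ c (fun i => u i - t * s) ≠ 0 := by
  classical
  change (if _ then _ else _) ≠ (0 : k) at h
  rw [ite_ne_right_iff] at h
  obtain ⟨⟨⟨t, rfl⟩, _⟩, h⟩ := h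
  refine ⟨t, rfl, ?_⟩
  convert h using 3
  ring

theorem column_apply_eq_zero {b : Fin d → ℤ} (c : (Fin d → ℤ) → k) (u : Fin d → ℤ)
    {w : Fin d → ℤ} (hw : ¬ ∃ t : ℤ, w = fun i => b i + t * s) : (column s b c).1 u w = 0 := by
  by_contra h
  obtain ⟨t, ht, _⟩ := exists_of_column_apply_ne_zero h
  exact hw ⟨t, ht⟩

theorem orbitAlgebra_apply_translate (f : orbitAlgebra k d s) (t : ℤ) (x y : Fin d → ℤ) :
    f.1 (fun i => x i + t * s) (fun i => y i + t * s) = f.1 x y := by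
  have hf : ∀ x y : Fin d → ℤ, f.1 (fun i => x i + s) (fun i => y i + s) = f.1 x y := f.2
  induction t using Int.induction_on with
  | zero => simp
  | succ t ih =>
    rw [← ih, ← hf (fun i => x i + t * s)]
    congr! 2 <;> ring
  | pred t ih =>
    rw [← ih, ← hf (fun i => x i + (-t - 1) * s)]
    congr! 2 <;> ring

/-- An element concentrated on the morphisms ending in translates of `b` is a column. -/
theorem eq_column (f : orbitAlgebra k d s) (b : Fin d → ℤ) (c : (Fin d → ℤ) → k)
    (hf : ∀ u w, f.1 u w ≠ 0 → ∃ t : ℤ, w = fun i => b i + t * s)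
    (hc : ∀ u, u ≤ b → f.1 u b = c u) : f = column s b c := by
  apply Subtype.ext
  ext u w huw
  by_cases hw : ∃ t : ℤ, w = fun i => b i + t * s
  · obtain ⟨t, rfl⟩ := hw
    have hu : u = fun i => (u i - t * s) + t * s := by ext i; ring
    have hub : (fun i => u i - t * s) ≤ b := fun i => by linarith [huw i]
    rw [hu, orbitAlgebra_apply_translate, orbitAlgebra_apply_translate (column s b c),
      column_apply_self _ _ hub, hc _ hub]
  · rw [not_not.1 fun h => hw (hf u w h), column_apply_eq_zero c u hw]

theorem column_congr {b : Fin d → ℤ} {c c' : (Fin d → ℤ) → k} (h : ∀ u, u ≤ b → c u = c' u) :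
    column s b c = column s b c' :=
  eq_column _ _ _ (fun u w huw => by
    obtain ⟨t, ht, _⟩ := exists_of_column_apply_ne_zero huw
    exact ⟨t, ht⟩) fun u hu => by rw [column_apply_self _ _ hu, h u hu]

theorem column_add (b : Fin d → ℤ) (c c' : (Fin d → ℤ) → k) :
    column s b (c + c') = column s b c + column s b c' := by
  refine (eq_column _ _ _ (fun u w huw => ?_) fun u hu => ?_).symm
  · by_contra hw
    refine huw ?_
    change (column s b c).1 u w + (column s b c').1 u w = 0
    rw [column_apply_eq_zero c u hw, column_apply_eq_zero c' u hw, add_zero]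
  · change (column s b c).1 u b + (column s b c').1 u b = _
    rw [column_apply_self _ _ hu, column_apply_self _ _ hu, Pi.add_apply]

/-- Columns at `b` thus form a left ideal, the projective at `b` before passing to the quotient, and
the action on coefficients has the shape of the action on interval modules. -/
theorem mul_column (f : orbitAlgebra k d s) (b : Fin d → ℤ) (c : (Fin d → ℤ) → k) :
    f * column s b c = column s b fun u => ∑ x ∈ Finset.Icc u b, f.1 u x * c x := by
  refine eq_column _ _ _ (fun u w huw => ?_) fun u hu => ?_
  · change (f.1 * (column s b c).1) u w ≠ 0 at huw
    rw [IncidenceAlgebra.mul_apply] at huw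
    obtain ⟨x, _, hx⟩ := Finset.exists_ne_zero_of_sum_ne_zero huw
    obtain ⟨t, ht, _⟩ := exists_of_column_apply_ne_zero (right_ne_zero_of_mul hx)
    exact ⟨t, ht⟩
  · change (f.1 * (column s b c).1) u b = _
    rw [IncidenceAlgebra.mul_apply]
    refine Finset.sum_congr rfl fun x hx => ?_
    rw [column_apply_self _ _ (Finset.mem_Icc.1 hx).2]

/-- The morphism `x ⟶ b` as an element of the orbit algebra. -/
def morphism (k : Type u) [Field k] {d : ℕ} (s : ℤ) (x b : Fin d → ℤ) : orbitAlgebra k d s :=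
  column s b (Pi.single x 1)

theorem exists_of_morphism_apply_ne_zero {x b u w : Fin d → ℤ} (h : (morphism k s x b).1 u w ≠ 0) :
    ∃ t : ℤ, (u = fun i => x i + t * s) ∧ w = fun i => b i + t * s := by
  obtain ⟨t, ht, h⟩ := exists_of_column_apply_ne_zero h
  refine ⟨t, ?_, ht⟩
  have : (fun i => u i - t * s) = x := by
    by_contra hx
    exact h (Pi.single_eq_of_ne hx _)
  ext i
  rw [← this]
  ring

theorem morphism_apply_self {x b : Fin d → ℤ} (h : x ≤ b) : (morphism k s x b).1 x b = 1 := by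
  rw [morphism, column_apply_self _ _ h, Pi.single_eq_same]

/-- In an incidence category every morphism `u ⟶ b` with `u ≤ w ≤ b` factors through `w`. A column
supported below `w` therefore dies as soon as the morphism `w ⟶ b` does. -/
theorem column_mul_morphism {w b : Fin d → ℤ} (hw : w ≤ b) (c : (Fin d → ℤ) → k)
    (hc : ∀ u, u ≤ b → c u ≠ 0 → u ≤ w) :
    column s w c * morphism k s w b = column s b c := by
  rw [morphism, mul_column]
  refine column_congr fun u hu => ?_
  by_cases huw : u ≤ w
  · rw [Finset.sum_eq_single w, column_apply_self _ _ huw, Pi.single_eq_same, mul_one]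
    · intro x _ hx
      rw [Pi.single_eq_of_ne hx, mul_zero]
    · intro h
      exact absurd (Finset.mem_Icc.2 ⟨huw, hw⟩) h
  · rw [not_not.1 fun h => huw (hc u hu h)]
    refine Finset.sum_eq_zero fun x _ => ?_
    by_cases hx : x = w
    · rw [hx, IncidenceAlgebra.apply_eq_zero_of_not_le huw, zero_mul]
    · rw [Pi.single_eq_of_ne hx, mul_zero]

end Column

/-! ### Vanishing in the quotient algebra -/

section Quotient

variable {k : Type u} [Field k] {d : ℕ} {s : ℤ} {U : Set (Fin d → ℤ)} {ℓ : ℤ → ℕ}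

/-- The class of an element of the orbit algebra. -/
def toQuotient (k : Type u) [Field k] {d : ℕ} (s : ℤ) (U : Set (Fin d → ℤ)) (ℓ : ℤ → ℕ) :
    orbitAlgebra k d s →+* QuotientAlgebra k d s U ℓ :=
  (TwoSidedIdeal.span (relations k d s U ℓ)).ringCon.mk'

theorem toQuotient_surjective :
    Function.Surjective (toQuotient k s U ℓ : orbitAlgebra k d s →+* QuotientAlgebra k d s U ℓ) :=
  RingCon.mk'_surjective _

theorem toQuotient_eq_zero_of_mem {f : orbitAlgebra k d s} (hf : f ∈ relations k d s U ℓ) :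
    toQuotient k s U ℓ f = 0 := by
  have h : f ∈ TwoSidedIdeal.span (relations k d s U ℓ) := TwoSidedIdeal.subset_span hf
  exact (RingCon.eq (TwoSidedIdeal.span (relations k d s U ℓ)).ringCon).2 h

theorem toQuotient_morphism_eq_zero (hU : ∀ x : Fin d → ℤ, ∀ t : ℤ, x ∉ U →
    (fun i => x i + t * s) ∉ U) {w b : Fin d → ℤ} (hwb : w ≤ b) (hw : w ∉ U) :
    toQuotient k s U ℓ (morphism k s w b) = 0 := by
  have h : morphism k s w w ∈ relations k d s U ℓ := by
    refine Or.inl fun x y hxy => ?_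
    obtain ⟨t, rfl, rfl⟩ := exists_of_morphism_apply_ne_zero hxy
    exact ⟨rfl, hU w t hw⟩
  have h' : morphism k s w w * morphism k s w b = morphism k s w b := by
    refine column_mul_morphism hwb _ fun u _ hu => ?_
    have : u = w := by
      by_contra hne
      exact hu (Pi.single_eq_of_ne hne _)
    exact this.le
  rw [← h', RingHom.map_mul, toQuotient_eq_zero_of_mem h, zero_mul]

theorem toQuotient_morphism_eq_zero_of_path (hd : d = 1)
    (hℓ : ∀ i t : ℤ, ℓ (i + t * s) = ℓ i) {w b : Fin d → ℤ} (h : ∀ i, w i = b i - ℓ (b i)) :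
    toQuotient k s U ℓ (morphism k s w b) = 0 := by
  refine toQuotient_eq_zero_of_mem (Or.inr ⟨hd, fun x y hxy i => ?_⟩)
  obtain ⟨t, rfl, rfl⟩ := exists_of_morphism_apply_ne_zero hxy
  simp only [hℓ, h i]
  ring

/-- A column vanishing on `[a, b]` is zero in the quotient algebra if the maximal vertices below
`b` and outside the cone above `a` give zero morphisms to `b`. -/
theorem toQuotient_column_eq_zero {a b : Fin d → ℤ} (hab : a ≤ b)
    (H : ∀ i, toQuotient k s U ℓ (morphism k s (Function.update b i (a i - 1)) b) = 0)
    (c : (Fin d → ℤ) → k) (hc : ∀ u ∈ Set.Icc a b, c u = 0) :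
    toQuotient k s U ℓ (column s b c) = 0 := by
  classical
  -- Induction on the set of coordinates that may drop below `a`. The part of the column with `u i <
  -- a i` factors through `b` with its `i`-th coordinate lowered to `a i - 1`.
  suffices h : ∀ T : Finset (Fin d), ∀ c : (Fin d → ℤ) → k,
      (∀ u, u ≤ b → c u ≠ 0 → ∃ i ∈ T, u i < a i) → toQuotient k s U ℓ (column s b c) = 0 by
    refine h Finset.univ c fun u hub hu => ?_
    by_contra! hau
    exact hu (hc u ⟨fun i => hau i (Finset.mem_univ i), hub⟩)
  intro T
  induction T using Finset.induction with
  | empty =>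
    intro c hc
    have : column s b c = 0 := by
      refine (eq_column 0 b c (fun u w h => absurd rfl h) fun u hu => ?_).symm
      by_contra! h
      obtain ⟨i, hi, _⟩ := hc u hu h.symm
      simp at hi
    rw [this, RingHom.map_zero]
  | insert i T _ ih =>
    intro c hc
    have hsplit : c = (fun u => if u i < a i then c u else 0) +
        fun u => if u i < a i then 0 else c u := by
      ext u
      by_cases h : u i < a i <;> simp [h]
    rw [hsplit, column_add, RingHom.map_add, ih (fun u => if u i < a i then 0 else c u), add_zero,
      ← column_mul_morphism (w := Function.update b i (a i - 1)), RingHom.map_mul, H, mul_zero]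
    · exact update_le_self_iff.2 (by linarith [hab i])
    · intro u hub hu
      rw [le_update_iff]
      refine ⟨?_, fun j _ => hub j⟩
      by_contra h
      exact hu (if_neg (by omega))
    · intro u hub hu
      have h1 : ¬ u i < a i := fun h => hu (if_pos h)
      rw [if_neg h1] at hu
      obtain ⟨j, hj, hlt⟩ := hc u hub hu
      rcases Finset.mem_insert.1 hj with rfl | hj
      · exact absurd hlt h1
      · exact ⟨j, hj, hlt⟩

end Quotient

/-! ### Interval modules: generators, canonical maps, projectivity -/

section IntervalModules

variable {k : Type u} [Field k] {d : ℕ} {s : ℤ} {U : Set (Fin d → ℤ)} {ℓ : ℤ → ℕ}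

open scoped Classical in
/-- Extension by zero of a function on the interval `[a, b]`. -/
def extendZero {a b : Fin d → ℤ} : IntervalSpace k a b →ₗ[k] ((Fin d → ℤ) → k) where
  toFun v u := if h : u ∈ Set.Icc a b then (show Set.Icc a b → k from v) ⟨u, h⟩ else 0
  map_add' v w := by
    ext u
    by_cases h : u ∈ Set.Icc a b
    · simp only [dif_pos h, Pi.add_apply]
      rfl
    · simp only [dif_neg h, Pi.add_apply, add_zero]
  map_smul' c v := by
    ext u
    by_cases h : u ∈ Set.Icc a b
    · simp only [dif_pos h, Pi.smul_apply]
      rfl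
    · simp only [dif_neg h, Pi.smul_apply, smul_zero]

theorem extendZero_of_notMem {a b : Fin d → ℤ} (v : IntervalSpace k a b) {u : Fin d → ℤ}
    (h : u ∉ Set.Icc a b) : extendZero v u = 0 :=
  dif_neg h

theorem mem_of_extendZero_ne_zero {a b : Fin d → ℤ} {v : IntervalSpace k a b} {u : Fin d → ℤ}
    (h : extendZero v u ≠ 0) : u ∈ Set.Icc a b :=
  by_contra fun hu => h (extendZero_of_notMem v hu)

/-- Restriction of a function to the interval `[a, b]`. -/
def restrictInterval (a b : Fin d → ℤ) : ((Fin d → ℤ) → k) →ₗ[k] IntervalSpace k a b where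
  toFun c := fun x : Set.Icc a b => c x.1
  map_add' _ _ := rfl
  map_smul' _ _ := rfl

theorem extendZero_restrictInterval {a b : Fin d → ℤ} (c : (Fin d → ℤ) → k) {u : Fin d → ℤ}
    (h : u ∈ Set.Icc a b) : extendZero (restrictInterval a b c) u = c u :=
  dif_pos h

theorem IntervalSpace.ext {a b : Fin d → ℤ} {v w : IntervalSpace k a b}
    (h : ∀ u ∈ Set.Icc a b, extendZero v u = extendZero w u) : v = w := by
  funext x
  have := h x.1 x.2
  rwa [show extendZero v x.1 = v x from dif_pos x.2,
    show extendZero w x.1 = w x from dif_pos x.2] at this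

variable {a b : Fin d → ℤ}

/-- The elements of an interval module are the functions on the interval. -/
def toFunction (h : IsAdmissibleInterval k s U ℓ a b) :
    (intervalModule h).obj ≃+ IntervalSpace k a b :=
  AddEquiv.refl _

/-- The value of an element of an interval module at a vertex, zero outside the interval. -/
def value (h : IsAdmissibleInterval k s U ℓ a b) :
    (intervalModule h).obj →+ ((Fin d → ℤ) → k) :=
  extendZero.toAddMonoidHom.comp (toFunction h).toAddMonoidHom

/-- The element of an interval module with prescribed values. -/
def ofFunction (h : IsAdmissibleInterval k s U ℓ a b) :
    ((Fin d → ℤ) → k) →+ (intervalModule h).obj :=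
  (toFunction h).symm.toAddMonoidHom.comp (restrictInterval a b).toAddMonoidHom

theorem value_ofFunction (h : IsAdmissibleInterval k s U ℓ a b) (c : (Fin d → ℤ) → k)
    {u : Fin d → ℤ} (hu : u ∈ Set.Icc a b) : value h (ofFunction h c) u = c u :=
  extendZero_restrictInterval c hu

theorem value_of_notMem (h : IsAdmissibleInterval k s U ℓ a b) (v : (intervalModule h).obj)
    {u : Fin d → ℤ} (hu : u ∉ Set.Icc a b) : value h v u = 0 :=
  extendZero_of_notMem (toFunction h v) hu

theorem mem_of_value_ne_zero {h : IsAdmissibleInterval k s U ℓ a b} {v : (intervalModule h).obj}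
    {u : Fin d → ℤ} (hu : value h v u ≠ 0) : u ∈ Set.Icc a b :=
  mem_of_extendZero_ne_zero hu

theorem value_ext {h : IsAdmissibleInterval k s U ℓ a b} {v w : (intervalModule h).obj}
    (H : ∀ u ∈ Set.Icc a b, value h v u = value h w u) : v = w :=
  IntervalSpace.ext (v := toFunction h v) (w := toFunction h w) H

theorem ofFunction_value (h : IsAdmissibleInterval k s U ℓ a b) (v : (intervalModule h).obj) :
    ofFunction h (value h v) = v :=
  value_ext fun _ hu => value_ofFunction h _ hu

theorem value_smul (h : IsAdmissibleInterval k s U ℓ a b) (f : orbitAlgebra k d s)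
    (v : (intervalModule h).obj) {x : Fin d → ℤ} (hx : x ∈ Set.Icc a b) :
    value h (toQuotient k s U ℓ f • v) x = ∑ y ∈ Finset.Icc a b, f.1 x y * value h v y := by
  have h1 : value h (toQuotient k s U ℓ f • v) x =
      ∑ y : Set.Icc a b, f.1 x y.1 * (show Set.Icc a b → k from v) y := dif_pos hx
  rw [h1]
  refine Finset.sum_bij (fun y _ => y.1) (fun y _ => Finset.mem_Icc.2 y.2)
    (fun _ _ _ _ e => Subtype.ext e)
    (fun y hy => ⟨⟨y, Finset.mem_Icc.1 hy⟩, Finset.mem_univ _, rfl⟩) fun y _ => ?_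
  rw [show value h v y.1 = (show Set.Icc a b → k from v) y from dif_pos y.2]

/-- The basis vector of an interval module at the vertex `x`. -/
def basisVector (h : IsAdmissibleInterval k s U ℓ a b) (x : Fin d → ℤ) : (intervalModule h).obj :=
  ofFunction h (Pi.single x 1)

theorem value_basisVector (h : IsAdmissibleInterval k s U ℓ a b) {x : Fin d → ℤ}
    (hx : x ∈ Set.Icc a b) : value h (basisVector h x) = Pi.single x 1 := by
  funext u
  by_cases hu : u ∈ Set.Icc a b
  · exact value_ofFunction h _ hu
  · rw [value_of_notMem h _ hu, Pi.single_eq_of_ne]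
    rintro rfl
    exact hu hx

/-- An interval module is generated by its basis vector at the top vertex. -/
theorem column_smul_basisVector (h : IsAdmissibleInterval k s U ℓ a b) (hab : a ≤ b)
    (c : (Fin d → ℤ) → k) :
    toQuotient k s U ℓ (column s b c) • basisVector h b = ofFunction h c := by
  have hb : b ∈ Set.Icc a b := ⟨hab, le_rfl⟩
  refine value_ext fun u hu => ?_
  rw [value_smul h _ _ hu, value_basisVector h hb, value_ofFunction h _ hu,
    Finset.sum_eq_single b, column_apply_self _ _ hu.2, Pi.single_eq_same, mul_one]
  · intro y _ hy
    rw [Pi.single_eq_of_ne hy, mul_zero]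
  · intro hb'
    exact absurd (Finset.mem_Icc.2 hb) hb'

theorem morphism_smul_basisVector (h : IsAdmissibleInterval k s U ℓ a b) (hab : a ≤ b)
    (x : Fin d → ℤ) :
    toQuotient k s U ℓ (morphism k s x b) • basisVector h b = basisVector h x :=
  column_smul_basisVector h hab _

theorem hom_ext_of_basisVector (h : IsAdmissibleInterval k s U ℓ a b) (hab : a ≤ b)
    {X : FinMod k (QuotientAlgebra k d s U ℓ)} {f g : intervalModule h ⟶ X}
    (hfg : f.hom.hom (basisVector h b) = g.hom.hom (basisVector h b)) : f = g := by
  ext v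
  rw [← ofFunction_value h v, ← column_smul_basisVector h hab, map_smul, map_smul, hfg]

/-- The canonical map between interval modules: restriction to the intersection of the intervals,
followed by extension by zero. -/
def intervalMap {a' b' : Fin d → ℤ} (h : IsAdmissibleInterval k s U ℓ a b)
    (h' : IsAdmissibleInterval k s U ℓ a' b') (ha : a ≤ a') (hb : b ≤ b') :
    intervalModule h ⟶ intervalModule h' :=
  FinMod.ofLinearMap
    { toFun := fun v => ofFunction h' (value h v)
      map_add' := fun v w => by rw [map_add, map_add]
      map_smul' := fun q v => by
        obtain ⟨f, rfl⟩ := toQuotient_surjective q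
        refine value_ext fun x hx => ?_
        rw [value_ofFunction h' _ hx, RingHom.id_apply, value_smul h' _ _ hx]
        -- If `x ≤ b`, the sums over `[a, b]` and `[a', b']` agree: a vertex only in the first is
        -- not above `x`, and at a vertex only in the second `v` is zero. Otherwise no vertex above
        -- `x` is below `b`, and both sides vanish.
        by_cases hxb : x ≤ b
        · rw [value_smul h _ _ ⟨ha.trans hx.1, hxb⟩]
          refine Finset.sum_congr_of_eq_on_inter ?_ ?_ ?_
          · intro y hy hy'
            rw [Finset.mem_Icc] at hy hy'
            rw [IncidenceAlgebra.apply_eq_zero_of_not_le, zero_mul]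
            exact fun hxy => hy' ⟨hx.1.trans hxy, hy.2.trans hb⟩
          · intro y hy hy'
            rw [Finset.mem_Icc] at hy hy'
            rw [value_ofFunction h' _ hy, value_of_notMem h _ hy', mul_zero]
          · intro y _ hy
            rw [value_ofFunction h' _ (Finset.mem_Icc.1 hy)]
        · rw [value_of_notMem h _ fun hx' => hxb hx'.2]
          refine (Finset.sum_eq_zero fun y hy => ?_).symm
          rw [value_ofFunction h' _ (Finset.mem_Icc.1 hy)]
          by_cases hyb : y ≤ b
          · rw [IncidenceAlgebra.apply_eq_zero_of_not_le fun hxy => hxb (hxy.trans hyb), zero_mul]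
          · rw [value_of_notMem h _ fun hy' => hyb hy'.2, mul_zero] }

section IntervalMap

variable {a' b' : Fin d → ℤ} (h : IsAdmissibleInterval k s U ℓ a b)
  (h' : IsAdmissibleInterval k s U ℓ a' b') (ha : a ≤ a') (hb : b ≤ b')

theorem intervalMap_apply (v : (intervalModule h).obj) :
    (intervalMap h h' ha hb).hom.hom v = ofFunction h' (value h v) :=
  rfl

theorem value_intervalMap (v : (intervalModule h).obj) {u : Fin d → ℤ} (hu : u ∈ Set.Icc a' b') :
    value h' ((intervalMap h h' ha hb).hom.hom v) u = value h v u := by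
  rw [intervalMap_apply, value_ofFunction h' _ hu]

include ha hb in
/-- The intervals `[a, b']` splitting into a down-set `[a, b]` and an up-set `[a', b']` give short
exact sequences of interval modules. -/
theorem shortExact_intervalMap (hP : IsAdmissibleInterval k s U ℓ a b')
    (hsplit : ∀ x ∈ Set.Icc a b', x ≤ b ↔ ¬ a' ≤ x) :
    ∃ w, (ShortComplex.mk (intervalMap h hP le_rfl hb)
      (intervalMap hP h' ha le_rfl) w).ShortExact := by
  have w : intervalMap h hP le_rfl hb ≫ intervalMap hP h' ha le_rfl = 0 := by
    ext v
    refine value_ext (h := h') fun u hu => ?_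
    change value h' ((intervalMap hP h' ha le_rfl).hom.hom
      ((intervalMap h hP le_rfl hb).hom.hom v)) u = value h' 0 u
    have hu' : u ∈ Set.Icc a b' := ⟨ha.trans hu.1, hu.2⟩
    rw [value_intervalMap _ _ _ _ _ hu, value_intervalMap _ _ _ _ _ hu', map_zero,
      value_of_notMem h _ fun hx => (hsplit u hu').1 hx.2 hu.1]
    rfl
  refine ⟨w, FinMod.shortExact ?_ ?_ ?_⟩
  · intro v v' hv
    refine value_ext (h := h) fun u hu => ?_
    have hu' : u ∈ Set.Icc a b' := ⟨hu.1, hu.2.trans hb⟩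
    rw [← value_intervalMap h hP le_rfl hb v hu', ← value_intervalMap h hP le_rfl hb v' hu']
    exact congrFun (congrArg (value hP) hv) u
  · intro v
    refine ⟨ofFunction hP (value h' v), value_ext (h := h') fun u hu => ?_⟩
    exact (value_intervalMap hP h' ha le_rfl _ hu).trans
      (value_ofFunction hP _ ⟨ha.trans hu.1, hu.2⟩)
  · intro v hv
    refine ⟨ofFunction h (value hP v), value_ext (h := hP) fun u hu => ?_⟩
    refine (value_intervalMap h hP le_rfl hb _ hu).trans ?_
    by_cases hub : u ≤ b
    · exact value_ofFunction h _ ⟨hu.1, hub⟩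
    · have hau : a' ≤ u := by
        by_contra hau
        exact hub ((hsplit u hu).2 hau)
      have hz := value_intervalMap hP h' ha le_rfl v ⟨hau, hu.2⟩
      rw [value_of_notMem h _ fun hx => hub hx.2, ← hz]
      exact ((congrFun (congrArg (value h') hv) u).trans
        (congrFun (map_zero (value h')) u)).symm

end IntervalMap

theorem toQuotient_column_congr (hab : a ≤ b)
    (H : ∀ i, toQuotient k s U ℓ (morphism k s (Function.update b i (a i - 1)) b) = 0)
    {c c' : (Fin d → ℤ) → k} (hc : ∀ u ∈ Set.Icc a b, c u = c' u) :
    toQuotient k s U ℓ (column s b c) = toQuotient k s U ℓ (column s b c') := by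
  rw [← add_sub_cancel c' c, column_add, RingHom.map_add,
    toQuotient_column_eq_zero hab H (c - c') fun u hu => sub_eq_zero.2 (hc u hu), add_zero]

/-- This is the linearity needed for `liftOfTop`. Multiplying columns may create coefficients
outside `[a, b]`, but by `H` these do not matter in the quotient. -/
theorem toQuotient_column_value_smul (h : IsAdmissibleInterval k s U ℓ a b) (hab : a ≤ b)
    (H : ∀ i, toQuotient k s U ℓ (morphism k s (Function.update b i (a i - 1)) b) = 0)
    (f : orbitAlgebra k d s) (v : (intervalModule h).obj) :
    toQuotient k s U ℓ (column s b (value h (toQuotient k s U ℓ f • v))) =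
      toQuotient k s U ℓ f * toQuotient k s U ℓ (column s b (value h v)) := by
  rw [← RingHom.map_mul, mul_column]
  refine toQuotient_column_congr hab H fun u hu => ?_
  rw [value_smul h _ _ hu]
  symm
  refine Finset.sum_subset (Finset.Icc_subset_Icc_left hu.1) fun y hy hy' => ?_
  rw [IncidenceAlgebra.apply_eq_zero_of_not_le, zero_mul]
  exact fun huy => hy' (Finset.mem_Icc.2 ⟨huy, (Finset.mem_Icc.1 hy).2⟩)

/-- If all morphisms to `b` from outside the interval `[a, b]` vanish, then the interval module
maps to every module, with prescribed image of its top up to the idempotent at `b`. -/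
def liftOfTop (h : IsAdmissibleInterval k s U ℓ a b) (hab : a ≤ b)
    (H : ∀ i, toQuotient k s U ℓ (morphism k s (Function.update b i (a i - 1)) b) = 0)
    {X : FinMod k (QuotientAlgebra k d s U ℓ)} (m : X.obj) : intervalModule h ⟶ X :=
  FinMod.ofLinearMap
    { toFun := fun v => toQuotient k s U ℓ (column s b (value h v)) • m
      map_add' := fun v w => by rw [map_add, column_add, RingHom.map_add, add_smul]
      map_smul' := fun q v => by
        obtain ⟨f, rfl⟩ := toQuotient_surjective q
        rw [toQuotient_column_value_smul h hab H, mul_smul, RingHom.id_apply] }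

theorem liftOfTop_apply (h : IsAdmissibleInterval k s U ℓ a b) (hab : a ≤ b)
    (H : ∀ i, toQuotient k s U ℓ (morphism k s (Function.update b i (a i - 1)) b) = 0)
    {X : FinMod k (QuotientAlgebra k d s U ℓ)} (m : X.obj) (v : (intervalModule h).obj) :
    (liftOfTop h hab H m).hom.hom v = toQuotient k s U ℓ (column s b (value h v)) • m :=
  rfl

/-- The interval module on `[a, b]` is projective if all morphisms to `b` from outside the interval
vanish. -/
theorem projective_intervalModule (h : IsAdmissibleInterval k s U ℓ a b) (hab : a ≤ b)
    (H : ∀ i, toQuotient k s U ℓ (morphism k s (Function.update b i (a i - 1)) b) = 0) :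
    Projective (intervalModule h) where
  factors {E X} f e _ := by
    -- The preimage `m` need not be fixed by the idempotent at `b`; `liftOfTop` applies that
    -- idempotent, which fixes the image of the top vector under `f`.
    obtain ⟨m, hm⟩ := FinMod.surjective_of_epi e (f.hom.hom (basisVector h b))
    refine ⟨liftOfTop h hab H m, hom_ext_of_basisVector h hab ?_⟩
    have h1 : (liftOfTop h hab H m ≫ e).hom.hom (basisVector h b) =
        e.hom.hom ((liftOfTop h hab H m).hom.hom (basisVector h b)) := rfl
    rw [h1, liftOfTop_apply, map_smul, hm, ← map_smul, column_smul_basisVector h hab,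
      ofFunction_value]

end IntervalModules

/-! ### Modules on one vertex, and summands of interval modules -/

section SchurSimples

variable {k : Type u} [Field k] {d : ℕ} {s : ℤ} {U : Set (Fin d → ℤ)} {ℓ : ℤ → ℕ}
  {a b : Fin d → ℤ}

theorem value_zero_apply (h : IsAdmissibleInterval k s U ℓ a b) (x : Fin d → ℤ) :
    value h 0 x = 0 := by
  rw [map_zero, Pi.zero_apply]

section OnePoint

theorem value_smul_onePoint (h : IsAdmissibleInterval k s U ℓ a a) (f : orbitAlgebra k d s)
    (v : (intervalModule h).obj) :
    value h (toQuotient k s U ℓ f • v) a = f.1 a a * value h v a := by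
  rw [value_smul h _ _ ⟨le_rfl, le_rfl⟩, Finset.Icc_self, Finset.sum_singleton]

theorem onePoint_ext {h : IsAdmissibleInterval k s U ℓ a a} {v w : (intervalModule h).obj}
    (H : value h v a = value h w a) : v = w :=
  value_ext fun u hu => by rwa [le_antisymm hu.2 hu.1]

theorem exists_smul_eq_onePoint {h : IsAdmissibleInterval k s U ℓ a a} {v : (intervalModule h).obj}
    (hv : v ≠ 0) (w : (intervalModule h).obj) :
    ∃ q : QuotientAlgebra k d s U ℓ, q • v = w := by
  have hv' : value h v a ≠ 0 := fun h0 => hv (onePoint_ext (by rw [h0, value_zero_apply]))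
  refine ⟨toQuotient k s U ℓ (column s a fun _ => value h w a / value h v a), onePoint_ext ?_⟩
  rw [value_smul_onePoint, column_apply_self _ _ le_rfl, div_mul_cancel₀ _ hv']

theorem surjective_of_ne_zero_onePoint {h : IsAdmissibleInterval k s U ℓ a a}
    {X : FinMod k (QuotientAlgebra k d s U ℓ)} {f : X ⟶ intervalModule h} (hf : f ≠ 0) :
    Function.Surjective f.hom.hom := by
  intro w
  obtain ⟨x, hx⟩ : ∃ x, f.hom.hom x ≠ 0 := by
    by_contra! hx
    exact hf (by ext x; exact hx x)
  obtain ⟨q, hq⟩ := exists_smul_eq_onePoint hx w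
  exact ⟨q • x, by rw [map_smul, hq]⟩

theorem injective_of_ne_zero_onePoint {h : IsAdmissibleInterval k s U ℓ a a}
    {X : FinMod k (QuotientAlgebra k d s U ℓ)} {f : intervalModule h ⟶ X} (hf : f ≠ 0) :
    Function.Injective f.hom.hom := by
  rw [injective_iff_map_eq_zero]
  intro v hv
  by_contra hne
  refine hf ?_
  ext w
  obtain ⟨q, rfl⟩ := exists_smul_eq_onePoint hne w
  rw [map_smul, hv, smul_zero]
  rfl

theorem basisVector_onePoint_ne_zero (h : IsAdmissibleInterval k s U ℓ a a) :
    basisVector h a ≠ 0 := by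
  intro h0
  have := congrFun (congrArg (value h) h0) a
  rw [value_basisVector h ⟨le_rfl, le_rfl⟩, Pi.single_eq_same, map_zero] at this
  exact one_ne_zero this

theorem not_isZero_onePoint (h : IsAdmissibleInterval k s U ℓ a a) :
    ¬ IsZero (intervalModule h) := by
  intro h0
  have h1 : (𝟙 (intervalModule h) : intervalModule h ⟶ intervalModule h) = 0 :=
    (IsZero.iff_id_eq_zero _).1 h0
  exact basisVector_onePoint_ne_zero h
    (congrArg (fun f : intervalModule h ⟶ intervalModule h => f.hom.hom (basisVector h a)) h1)

/-- The modules on intervals with one vertex are Schur simple in every full subcategory. -/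
theorem isSchurSimple_onePoint {P : ObjectProperty (FinMod k (QuotientAlgebra k d s U ℓ))}
    (h : IsAdmissibleInterval k s U ℓ a a) (hP : P (intervalModule h)) :
    IsSchurSimple (⟨intervalModule h, hP⟩ : P.FullSubcategory) := by
  refine ⟨fun h0 => not_isZero_onePoint h ?_, fun X f hf => ?_, fun Y f hf => ?_⟩
  · rw [IsZero.iff_id_eq_zero] at h0 ⊢
    exact congrArg InducedCategory.Hom.hom h0
  · have hf' : f.hom ≠ 0 := fun h0 => hf (by ext1; exact h0)
    have : Epi (P.ι.map f) := FinMod.epi_of_surjective f.hom (surjective_of_ne_zero_onePoint hf')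
    exact P.ι.epi_of_epi_map this
  · have hf' : f.hom ≠ 0 := fun h0 => hf (by ext1; exact h0)
    have : Mono (P.ι.map f) := FinMod.mono_of_injective f.hom (injective_of_ne_zero_onePoint hf')
    exact P.ι.mono_of_mono_map this

/-- The canonical map between the modules on the vertex `a` and on its translate. -/
def translateMap {a' : Fin d → ℤ} (h : IsAdmissibleInterval k s U ℓ a a)
    (h' : IsAdmissibleInterval k s U ℓ a' a') (ht : ∃ t : ℤ, a' = fun i => a i + t * s) :
    intervalModule h ⟶ intervalModule h' :=
  FinMod.ofLinearMap
    { toFun := fun v => ofFunction h' fun _ => value h v a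
      map_add' := fun v w => onePoint_ext (h := h') (by
        rw [value_ofFunction h' _ ⟨le_rfl, le_rfl⟩, map_add, map_add, Pi.add_apply, Pi.add_apply,
          value_ofFunction h' _ ⟨le_rfl, le_rfl⟩, value_ofFunction h' _ ⟨le_rfl, le_rfl⟩])
      map_smul' := fun q v => onePoint_ext (h := h') (by
        obtain ⟨f, rfl⟩ := toQuotient_surjective q
        obtain ⟨t, rfl⟩ := ht
        rw [RingHom.id_apply, value_smul_onePoint h', value_ofFunction h' _ ⟨le_rfl, le_rfl⟩,
          value_smul_onePoint h, value_ofFunction h' _ ⟨le_rfl, le_rfl⟩,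
          orbitAlgebra_apply_translate]) }

theorem value_translateMap {a' : Fin d → ℤ} (h : IsAdmissibleInterval k s U ℓ a a)
    (h' : IsAdmissibleInterval k s U ℓ a' a') (ht : ∃ t : ℤ, a' = fun i => a i + t * s)
    (v : (intervalModule h).obj) :
    value h' ((translateMap h h' ht).hom.hom v) a' = value h v a := by
  have h1 : (translateMap h h' ht).hom.hom v = ofFunction h' fun _ => value h v a := rfl
  rw [h1, value_ofFunction h' _ ⟨le_rfl, le_rfl⟩]

theorem nonempty_iso_onePoint {a' : Fin d → ℤ} (h : IsAdmissibleInterval k s U ℓ a a)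
    (h' : IsAdmissibleInterval k s U ℓ a' a') (ht : ∃ t : ℤ, a' = fun i => a i + t * s) :
    Nonempty (intervalModule h ≅ intervalModule h') := by
  have ht' : ∃ t : ℤ, a = fun i => a' i + t * s := by
    obtain ⟨t, rfl⟩ := ht
    exact ⟨-t, funext fun i => by ring⟩
  refine ⟨⟨translateMap h h' ht, translateMap h' h ht', ?_, ?_⟩⟩
  · ext v
    exact onePoint_ext (h := h) ((value_translateMap h' h ht' _).trans
      (value_translateMap h h' ht _))
  · ext v
    exact onePoint_ext (h := h') ((value_translateMap h h' ht _).trans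
      (value_translateMap h' h ht' _))

/-- The top vector generates and is fixed by the idempotent at `b`, which acts as zero on a vertex
that is not a translate of `b`. -/
theorem eq_zero_of_not_translate {c : Fin d → ℤ} (h : IsAdmissibleInterval k s U ℓ a b)
    (hab : a ≤ b) (hc : IsAdmissibleInterval k s U ℓ c c) (ht : ¬ ∃ t : ℤ, c = fun i => b i + t * s)
    (φ : intervalModule h ⟶ intervalModule hc) : φ = 0 := by
  refine hom_ext_of_basisVector h hab (onePoint_ext (h := hc) ?_)
  rw [← morphism_smul_basisVector h hab b, map_smul, value_smul_onePoint,
    morphism, column_apply_eq_zero _ _ ht, zero_mul]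
  exact (value_zero_apply hc c).symm

theorem exists_translate_of_iso {a' : Fin d → ℤ} (h : IsAdmissibleInterval k s U ℓ a a)
    (h' : IsAdmissibleInterval k s U ℓ a' a') (e : intervalModule h ≅ intervalModule h') :
    ∃ t : ℤ, a' = fun i => a i + t * s := by
  by_contra ht
  refine not_isZero_onePoint h ((IsZero.iff_id_eq_zero _).2 ?_)
  rw [← e.hom_inv_id, eq_zero_of_not_translate h le_rfl h' ht e.hom, zero_comp]

/-- A map to a one-vertex module sees only the coefficient at the top `b'`, and `b'` is not in `[a,
b]`. This is the degree-zero input for dimension shifting. -/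
theorem intervalMap_comp_eq_zero {b' c : Fin d → ℤ} (h : IsAdmissibleInterval k s U ℓ a b)
    (h' : IsAdmissibleInterval k s U ℓ a b') (hab : a ≤ b) (hb : b < b')
    (hc : IsAdmissibleInterval k s U ℓ c c) (φ : intervalModule h' ⟶ intervalModule hc) :
    intervalMap h h' le_rfl hb.le ≫ φ = 0 := by
  ext v
  refine onePoint_ext (h := hc) ?_
  have h1 : (intervalMap h h' le_rfl hb.le ≫ φ).hom.hom v =
    φ.hom.hom ((intervalMap h h' le_rfl hb.le).hom.hom v) := rfl
  have hab' := hab.trans hb.le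
  rw [h1, ← ofFunction_value h' ((intervalMap h h' le_rfl hb.le).hom.hom v),
    ← column_smul_basisVector h' hab', map_smul, value_smul_onePoint]
  refine Eq.trans ?_ (value_zero_apply hc c).symm
  rw [mul_eq_zero, or_iff_not_imp_left]
  intro hne
  obtain ⟨t, ht, hne⟩ := exists_of_column_apply_ne_zero hne
  have hcb : (fun i => c i - t * s) = b' := by
    rw [ht]
    ext i
    ring
  rw [hcb, value_intervalMap _ _ _ _ _ ⟨hab', le_rfl⟩] at hne
  exact absurd (mem_of_value_ne_zero hne).2 hb.not_ge

theorem value_algebraMap_smul (h : IsAdmissibleInterval k s U ℓ a b) (γ : k)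
    (v : (intervalModule h).obj) (x : Fin d → ℤ) :
    value h (algebraMap k (QuotientAlgebra k d s U ℓ) γ • v) x = γ * value h v x := by
  have h1 : algebraMap k (QuotientAlgebra k d s U ℓ) γ • v =
      (toFunction h).symm (γ • toFunction h v) := by
    change intervalAction h (algebraMap k _ γ) (toFunction h v) = γ • toFunction h v
    rw [AlgHom.commutes]
    rfl
  rw [h1]
  exact congrFun (extendZero.map_smul γ (toFunction h v)) x

/-- A morphism is determined by the scalar to which it sends the top vector; projection to the top
followed by translation realizes the scalar `1`. -/
theorem rank_hom_onePoint {c : Fin d → ℤ} (h : IsAdmissibleInterval k s U ℓ a b)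
    (hab : a ≤ b) (hb : IsAdmissibleInterval k s U ℓ b b) (hc : IsAdmissibleInterval k s U ℓ c c)
    (ht : ∃ t : ℤ, c = fun i => b i + t * s) :
    Module.rank k (intervalModule h ⟶ intervalModule hc) = 1 := by
  let φ₀ : intervalModule h ⟶ intervalModule hc :=
    intervalMap h hb hab le_rfl ≫ translateMap hb hc ht
  have hbm : b ∈ Set.Icc a b := ⟨hab, le_rfl⟩
  have h1 : value hc (φ₀.hom.hom (basisVector h b)) c = 1 := by
    have h2 : φ₀.hom.hom (basisVector h b) = (translateMap hb hc ht).hom.hom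
      ((intervalMap h hb hab le_rfl).hom.hom (basisVector h b)) := rfl
    rw [h2, value_translateMap, value_intervalMap _ _ _ _ _ ⟨le_rfl, le_rfl⟩,
      value_basisVector h hbm, Pi.single_eq_same]
  rw [rank_eq_one_iff]
  refine ⟨φ₀, fun h0 => ?_, fun φ => ⟨value hc (φ.hom.hom (basisVector h b)) c, ?_⟩⟩
  · rw [h0] at h1
    exact zero_ne_one ((value_zero_apply hc c).symm.trans h1)
  · refine hom_ext_of_basisVector h hab (onePoint_ext (h := hc) ?_)
    refine (value_algebraMap_smul hc _ (φ₀.hom.hom (basisVector h b)) c).trans ?_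
    rw [h1, mul_one]

end OnePoint

section Endomorphisms

/-- An endomorphism is a combination of translations by multiples `t * s ≤ 0`, with coefficients
read off from the image of the top vector. In the orbit category such endomorphisms need not be
scalar. -/
theorem exists_of_value_endomorphism_ne_zero [NeZero d] (h : IsAdmissibleInterval k s U ℓ a b)
    (hab : a ≤ b) (φ : intervalModule h ⟶ intervalModule h) {v : (intervalModule h).obj}
    {u : Fin d → ℤ} (hu : value h (φ.hom.hom v) u ≠ 0) :
    ∃ t : ℤ, t * s ≤ 0 ∧ value h v (fun i => u i - t * s) ≠ 0 ∧
      value h (φ.hom.hom (basisVector h b)) (fun i => b i + t * s) ≠ 0 := by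
  have hum := mem_of_value_ne_zero hu
  rw [← ofFunction_value h v, ← column_smul_basisVector h hab, map_smul, value_smul h _ _ hum] at hu
  obtain ⟨y, hy, hne⟩ := Finset.exists_ne_zero_of_sum_ne_zero hu
  obtain ⟨t, rfl, hv⟩ := exists_of_column_apply_ne_zero (left_ne_zero_of_mul hne)
  exact ⟨t, by linarith [(Finset.mem_Icc.1 hy).2 0], hv, right_ne_zero_of_mul hne⟩

/-- Both sides are the coefficient of the trivial translation, since the morphism `a ⟶ b` has a
non-zero entry in row `a` only at `b`. -/
theorem value_endomorphism_bottom [NeZero d] (h : IsAdmissibleInterval k s U ℓ a b) (hab : a ≤ b)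
    (φ : intervalModule h ⟶ intervalModule h) :
    value h (φ.hom.hom (basisVector h a)) a = value h (φ.hom.hom (basisVector h b)) b := by
  rw [← morphism_smul_basisVector h hab a, map_smul, value_smul h _ _ ⟨le_rfl, hab⟩,
    Finset.sum_eq_single b, morphism_apply_self hab, one_mul]
  · intro y _ hy
    rw [mul_eq_zero, or_iff_not_imp_left]
    intro hne
    obtain ⟨t, h1, rfl⟩ := exists_of_morphism_apply_ne_zero hne
    refine absurd (funext fun i => ?_) hy
    linarith [congrFun h1 i]
  · intro hb
    exact absurd (Finset.mem_Icc.2 ⟨hab, le_rfl⟩) hb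

/-- An idempotent endomorphism of an interval module that is nilpotent on the top is zero. -/
theorem idempotent_eq_zero [NeZero d] (h : IsAdmissibleInterval k s U ℓ a b) (hab : a ≤ b)
    (e : intervalModule h ⟶ intervalModule h) (he : e ≫ e = e)
    (hb : value h (e.hom.hom (basisVector h b)) b = 0) : e = 0 := by
  -- Without a trivial translation part, `e` strictly lowers the first coordinate of the support;
  -- idempotency allows `e` to be applied again until the support leaves the interval.
  have key : ∀ N : ℕ, ∀ v : (intervalModule h).obj,
      (∀ u, value h v u ≠ 0 → u 0 - a 0 < N) → e.hom.hom v = 0 := by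
    intro N
    induction N with
    | zero =>
      intro v hv
      have : v = 0 := value_ext (h := h) fun u hu => by
        rw [map_zero]
        by_contra hne
        have h1 := hv u hne
        have h2 := hu.1 0
        push_cast at h1
        linarith
      rw [this, map_zero]
    | succ N ih =>
      intro v hv
      have hee : e.hom.hom v = e.hom.hom (e.hom.hom v) :=
        congrArg (fun f : intervalModule h ⟶ intervalModule h => f.hom.hom v) he.symm
      rw [hee]
      refine ih _ fun u hu => ?_
      obtain ⟨t, ht, h1, h2⟩ := exists_of_value_endomorphism_ne_zero h hab e hu
      have ht' : t * s ≠ 0 := fun h0 => h2 (by simpa only [h0, add_zero] using hb)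
      have h3 := hv _ h1
      push_cast at h3
      have h4 : t * s < 0 := lt_of_le_of_ne ht ht'
      linarith
  ext v
  refine key (b 0 - a 0 + 1).toNat v fun u hu => ?_
  have h1 := (mem_of_value_ne_zero hu).2 0
  have h2 := hab 0
  rw [Int.toNat_of_nonneg (by linarith)]
  linarith

theorem comp_eq_zero_or_of_isSchurSimple {C : Type v} [Category.{w} C] [Preadditive C]
    {P : ObjectProperty C} {X : P.FullSubcategory} (hX : IsSchurSimple X) {Y Z : C} (hY : P Y)
    (hZ : P Z) (f : Z ⟶ X.obj) (g : X.obj ⟶ Y) (hfg : f ≫ g = 0) : f = 0 ∨ g = 0 := by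
  rw [or_iff_not_imp_left]
  intro hf
  have : Epi (P.homMk f : (⟨Z, hZ⟩ : P.FullSubcategory) ⟶ X) :=
    hX.2.1 _ fun h0 => hf (congrArg InducedCategory.Hom.hom h0)
  have h1 : (P.homMk f : (⟨Z, hZ⟩ : P.FullSubcategory) ⟶ X) ≫
      (P.homMk g : X ⟶ (⟨Y, hY⟩ : P.FullSubcategory)) = 0 := by
    ext1
    exact hfg
  exact congrArg InducedCategory.Hom.hom (zero_of_epi_comp _ h1)

/-- A direct summand of an interval module `[a, b]` with at least two vertices is not Schur simple,
provided there are interval modules with top `a` and with socle `b`. -/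
theorem eq_of_isSchurSimple_retract [NeZero d]
    {P : ObjectProperty (FinMod k (QuotientAlgebra k d s U ℓ))}
    {X : P.FullSubcategory} (hX : IsSchurSimple X) (h : IsAdmissibleInterval k s U ℓ a b)
    (hab : a ≤ b) (ρ : Retract X.obj (intervalModule h)) {a' b' : Fin d → ℤ} (ha' : a' ≤ a)
    (hb' : b ≤ b') (h₁ : IsAdmissibleInterval k s U ℓ a' a) (h₂ : IsAdmissibleInterval k s U ℓ b b')
    (hP₁ : P (intervalModule h₁)) (hP₂ : P (intervalModule h₂)) : a = b := by
  by_contra hne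
  let f := intervalMap h₁ h ha' hab
  let g := intervalMap h h₂ hab hb'
  let e : intervalModule h ⟶ intervalModule h := ρ.r ≫ ρ.i
  have he : e ≫ e = e := by simp [e]
  have ham : a ∈ Set.Icc a b := ⟨le_rfl, hab⟩
  -- Otherwise the idempotent `e` onto `X` would vanish, and `X` with it.
  have hc : value h (e.hom.hom (basisVector h b)) b ≠ 0 := by
    intro h0
    have h1 := idempotent_eq_zero h hab e he h0
    refine hX.1 ((IsZero.iff_id_eq_zero X).2 ?_)
    ext1
    change 𝟙 X.obj = 0
    calc 𝟙 X.obj = ρ.i ≫ e ≫ ρ.r := by simp [e]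
      _ = 0 := by rw [h1, zero_comp, comp_zero]
  -- The image of `f` is supported at `a`, `e` only moves supports down, and `g` keeps only vertices
  -- above `b`; survival would force `b ≤ a`.
  have hzero : (f ≫ ρ.r) ≫ (ρ.i ≫ g) = 0 := by
    ext v
    refine value_ext (h := h₂) fun u hu => ?_
    refine Eq.trans ?_ (value_zero_apply h₂ u).symm
    refine (value_intervalMap h h₂ hab hb' (e.hom.hom (f.hom.hom v)) hu).trans ?_
    by_contra hne'
    obtain ⟨t, ht, h1, -⟩ := exists_of_value_endomorphism_ne_zero h hab e hne'
    rw [value_intervalMap h₁ h ha' hab v (mem_of_value_ne_zero h1)] at h1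
    have h2 := (mem_of_value_ne_zero h1).2
    refine hne (le_antisymm hab fun i => ?_)
    linarith [h2 i, hu.1 i]
  -- Either alternative makes the trivial translation coefficient of `e` vanish: the first is read
  -- at the socle `a`, the second at the top `b`.
  rcases comp_eq_zero_or_of_isSchurSimple hX hP₂ hP₁ _ _ hzero with h0 | h0
  · have h1 : f ≫ e = 0 := by
      rw [← Category.assoc, h0, zero_comp]
    have h2 : f.hom.hom (basisVector h₁ a) = basisVector h a := by
      refine value_ext (h := h) fun u hu => ?_
      rw [value_intervalMap h₁ h ha' hab _ hu, value_basisVector h₁ ⟨ha', le_rfl⟩,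
        value_basisVector h ham]
    have h3 : e.hom.hom (f.hom.hom (basisVector h₁ a)) = 0 :=
      congrArg (fun φ : intervalModule h₁ ⟶ intervalModule h => φ.hom.hom (basisVector h₁ a)) h1
    rw [h2] at h3
    rw [← value_endomorphism_bottom h hab e, h3] at hc
    exact hc (value_zero_apply h a)
  · have h1 : e ≫ g = 0 := by
      rw [Category.assoc, h0, comp_zero]
    have h2 : g.hom.hom (e.hom.hom (basisVector h b)) = 0 :=
      congrArg (fun φ : intervalModule h ⟶ intervalModule h₂ => φ.hom.hom (basisVector h b)) h1
    refine hc ?_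
    rw [← value_intervalMap h h₂ hab hb' _ ⟨le_rfl, hb'⟩, h2]
    exact (value_zero_apply h₂ b)

theorem nonempty_iso_of_retract_onePoint {X : FinMod k (QuotientAlgebra k d s U ℓ)}
    (hX : ¬ IsZero X) (h : IsAdmissibleInterval k s U ℓ a a) (ρ : Retract X (intervalModule h)) :
    Nonempty (intervalModule h ≅ X) := by
  have hi : ρ.i ≠ 0 := fun h0 => hX ((IsZero.iff_id_eq_zero X).2 (by
    rw [← ρ.retract, h0, zero_comp]))
  have : Epi ρ.i := FinMod.epi_of_surjective _ (surjective_of_ne_zero_onePoint hi)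
  have : IsIso ρ.i := isIso_of_epi_of_isSplitMono ρ.i
  exact ⟨(asIso ρ.i).symm⟩

end Endomorphisms

end SchurSimples

/-! ### Projective resolutions of the modules on the vertices `(i, …, i)` -/

section Resolutions

variable {k : Type u} [Field k] {d : ℕ} {s : ℤ} {U : Set (Fin d → ℤ)}

theorem IsAdmissibleInterval.mono {ℓ : ℤ → ℕ} {a b a' b' : Fin d → ℤ}
    (h : IsAdmissibleInterval k s U ℓ a b) (ha : a ≤ a') (hb : b' ≤ b) :
    IsAdmissibleInterval k s U ℓ a' b' :=
  fun f hf x hx y hy => h f hf x (Set.Icc_subset_Icc ha hb hx) y (Set.Icc_subset_Icc ha hb hy)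

theorem intervalModule_congr {ℓ : ℤ → ℕ} {a b a' b' : Fin d → ℤ} (ha : a = a') (hb : b = b')
    (h : IsAdmissibleInterval k s U ℓ a b) (h' : IsAdmissibleInterval k s U ℓ a' b') :
    intervalModule h = intervalModule h' := by
  subst ha hb
  rfl

/-- Dimension shifting along a projective resolution by interval modules `[a (j + 1), b j]` with
syzygies `[a j, b j]`. -/
theorem extDim_of_interval_resolution {ℓ : ℤ → ℕ} (N : ℕ) (a b : ℕ → Fin d → ℤ)
    (hK : ∀ j ≤ N, IsAdmissibleInterval k s U ℓ (a j) (b j))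
    (hP : ∀ j < N, IsAdmissibleInterval k s U ℓ (a (j + 1)) (b j))
    (hab : ∀ j ≤ N, a j ≤ b j) (ha : ∀ j < N, a (j + 1) ≤ a j) (hb : ∀ j < N, b (j + 1) < b j)
    (hsplit : ∀ j < N, ∀ x ∈ Set.Icc (a (j + 1)) (b j), x ≤ b (j + 1) ↔ ¬ a j ≤ x)
    (hproj : ∀ j (hj : j < N), Projective (intervalModule (hP j hj)))
    {c : Fin d → ℤ} (hc : IsAdmissibleInterval k s U ℓ c c) (r j : ℕ) (hrj : r + j = N) :
    extDim k r (intervalModule (hK j (by omega))) (intervalModule hc) =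
      extDim k 0 (intervalModule (hK N le_rfl)) (intervalModule hc) := by
  induction r generalizing j with
  | zero =>
    obtain rfl : j = N := by omega
    rfl
  | succ r ih =>
    have hj : j < N := by omega
    rw [← ih (j + 1) (by omega)]
    obtain ⟨w, hS⟩ := shortExact_intervalMap (hK (j + 1) hj) (hK j hj.le) (ha j hj) (hb j hj).le
      (hP j hj) (hsplit j hj)
    have := hproj j hj
    exact extDim_succ_of_shortExact k hS (intervalModule hc) r fun _ φ =>
      intervalMap_comp_eq_zero (hK (j + 1) hj) (hP j hj) (hab (j + 1) hj) (hb j hj) hc φ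

/-- The vertex `(i, …, i, i - 1, …, i - 1)` with `j` entries `i - 1`. -/
def syzygyTop (d : ℕ) (i : ℤ) (j : ℕ) : Fin d → ℤ :=
  fun p => if p.1 + j < d then i else i - 1

/-- The vertex `(i, …, i, i - 1, …, i - 1, m)` with `j - 1` entries `i - 1` if `j ≠ 0`, and
`(i, …, i)` if `j = 0`. -/
def syzygyBot (d : ℕ) (i m : ℤ) (j : ℕ) : Fin d → ℤ :=
  fun p => if j ≠ 0 ∧ p.1 + 1 = d then m else syzygyTop d i j p

theorem syzygyTop_zero (d : ℕ) (i : ℤ) : syzygyTop d i 0 = fun _ => i :=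
  funext fun p => if_pos (by omega)

theorem syzygyBot_zero (d : ℕ) (i m : ℤ) : syzygyBot d i m 0 = fun _ => i :=
  funext fun p => (if_neg (by simp)).trans (if_pos (by omega))

theorem syzygyTop_self (d : ℕ) (i : ℤ) : syzygyTop d i d = fun _ => i - 1 :=
  funext fun p => if_neg (by omega)

theorem syzygyTop_succ_le (i : ℤ) (j : ℕ) : syzygyTop d i (j + 1) ≤ syzygyTop d i j := by
  intro p
  simp only [syzygyTop]
  split_ifs <;> omega

theorem syzygyTop_succ_lt (i : ℤ) {j : ℕ} (hj : j < d) :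
    syzygyTop d i (j + 1) < syzygyTop d i j := by
  refine Pi.lt_def.2 ⟨syzygyTop_succ_le i j, ⟨d - 1 - j, by omega⟩, ?_⟩
  simp only [syzygyTop]
  rw [if_neg (by omega), if_pos (by omega)]
  omega

theorem syzygyBot_le (i : ℤ) {m : ℤ} (hm : m ≤ i - 1) (j : ℕ) :
    syzygyBot d i m j ≤ syzygyTop d i j := by
  intro p
  simp only [syzygyBot, syzygyTop]
  split_ifs <;> omega

theorem syzygyBot_succ_le (i : ℤ) {m : ℤ} (hm : m ≤ i - 1) (j : ℕ) :
    syzygyBot d i m (j + 1) ≤ syzygyBot d i m j := by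
  intro p
  simp only [syzygyBot, syzygyTop]
  split_ifs <;> omega

/-- Only the coordinate `d - 1 - j` matters: its value is at most `i - 1` on the left and equal to
`i` on the right. At every other coordinate both bounds hold automatically. -/
theorem le_syzygyTop_succ_iff (i m : ℤ) {j : ℕ} (hj : j < d) {x : Fin d → ℤ}
    (hx : x ∈ Set.Icc (syzygyBot d i m (j + 1)) (syzygyTop d i j)) :
    x ≤ syzygyTop d i (j + 1) ↔ ¬ syzygyBot d i m j ≤ x := by
  let q : Fin d := ⟨d - 1 - j, by omega⟩
  constructor
  · intro h1 h2
    have h3 := h1 q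
    have h4 := h2 q
    simp only [syzygyTop, syzygyBot, q] at h3 h4
    rw [if_neg (by omega)] at h3
    rw [if_neg (by omega), if_pos (by omega)] at h4
    omega
  · intro h1
    have h2 : x q ≤ i - 1 := by
      by_contra h2
      refine h1 fun p => ?_
      have h3 := hx.1 p
      by_cases hp : p = q
      · subst hp
        simp only [syzygyTop, syzygyBot, q] at h2 ⊢
        rw [if_neg (by omega), if_pos (by omega)]
        omega
      · have hp' : p.1 ≠ d - 1 - j := fun h => hp (Fin.ext h)
        simp only [syzygyTop, syzygyBot] at h3 ⊢
        split_ifs at h3 ⊢ <;> omega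
    intro p
    have h3 := hx.2 p
    by_cases hp : p = q
    · subst hp
      refine h2.trans ?_
      simp only [syzygyTop]
      split_ifs <;> omega
    · have hp' : p.1 ≠ d - 1 - j := fun h => hp (Fin.ext h)
      simp only [syzygyTop] at h3 ⊢
      split_ifs at h3 ⊢ <;> omega

theorem fin_val_top_add_one [NeZero d] : (⊤ : Fin d).1 + 1 = d := by
  have h1 : (⟨d - 1, Nat.sub_lt (Nat.pos_of_ne_zero (NeZero.ne d)) one_pos⟩ : Fin d) ≤ ⊤ := le_top
  have h2 : d - 1 ≤ (⊤ : Fin d).1 := h1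
  have h3 := (⊤ : Fin d).2
  omega

section Nakayama

variable {n : ℕ} [NeZero n] {ℓ : Fin n → ℕ} [NeZero d]

/-- The interval belongs to the sequence with `d - j` entries `i`, then `j` entries `i - 1`, then
`m`. The choice of `m` makes its length bound an equality. -/
theorem isAdmissibleInterval_syzygy (hℓ : IsKupisch ℓ) {i m : ℤ}
    (hm : m = i - periodicExt ℓ i + 1)
    (hU : ∀ x ∈ osCyc d ℓ, x 0 ≤ i → m ≤ x ⊤ → x ∈ U) {j : ℕ} (hj : j < d) :
    IsAdmissibleInterval k s U (periodicExt ℓ) (syzygyBot d i m (j + 1)) (syzygyTop d i j) := by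
  let l : Fin (d + 1) → ℤ := fun p => if p.1 = d then m else if p.1 + j < d then i else i - 1
  have h0 : l 0 = i := (if_neg (NeZero.ne d).symm).trans (if_pos (by rw [Fin.val_zero]; omega))
  have h1 : l ⊤ = m := if_pos rfl
  have hinit : Fin.init l = syzygyTop d i j := by
    funext p
    exact if_neg p.2.ne
  have htail : Fin.tail l = syzygyBot d i m (j + 1) := by
    funext p
    simp only [Fin.tail, l, syzygyBot, syzygyTop, Fin.val_succ]
    split_ifs <;> omega
  have hl : l 0 - l ⊤ + 1 ≤ periodicExt ℓ (l 0) := by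
    rw [h0, h1]
    omega
  rw [← hinit, ← htail]
  refine isAdmissibleInterval k d hℓ s U l hl fun x hx => ?_
  have hb := interval_bounds d hℓ hl hx
  rw [h0, h1] at hb
  exact hU x ⟨mem_os_of_mem_interval d hx, hb.2.2⟩ hb.1 hb.2.1

/-- Each bottom entry except the last equals the next entry of the top, so lowering it further
destroys monotonicity. Lowering the last entry to `m - 1` exceeds the length `ℓ_i`; for `d = 1` this
is exactly the extra path relation. -/
theorem toQuotient_morphism_syzygyTop (hU : ∀ x : Fin d → ℤ, ∀ t : ℤ, x ∉ U →
    (fun i => x i + t * s) ∉ U) (hU' : U ⊆ osCyc d ℓ)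
    (hs : ∀ i t : ℤ, periodicExt ℓ (i + t * s) = periodicExt ℓ i) {i m : ℤ}
    (hm : m = i - periodicExt ℓ i + 1) (hmi : m ≤ i) {j : ℕ} (hj : j < d) (q : Fin d) :
    toQuotient k s U (periodicExt ℓ) (morphism k s
      (Function.update (syzygyTop d i j) q (syzygyBot d i m (j + 1) q - 1))
      (syzygyTop d i j)) = 0 := by
  have hle : Function.update (syzygyTop d i j) q (syzygyBot d i m (j + 1) q - 1) ≤
      syzygyTop d i j := by
    refine update_le_self_iff.2 ?_
    simp only [syzygyTop, syzygyBot]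
    split_ifs <;> omega
  by_cases hq : q.1 + 1 < d
  · refine toQuotient_morphism_eq_zero hU hle fun hmem => ?_
    have hanti : Antitone _ := (hU' hmem).1
    have h1 := hanti (show q ≤ ⟨q.1 + 1, hq⟩ from Nat.le_succ _)
    rw [Function.update_self, Function.update_of_ne (by simp [Fin.ext_iff])] at h1
    simp only [syzygyTop, syzygyBot] at h1
    split_ifs at h1 <;> omega
  · have hq' : q.1 + 1 = d := by omega
    have hqm : syzygyBot d i m (j + 1) q = m := if_pos ⟨by omega, hq'⟩
    by_cases hd : d = 1
    · refine toQuotient_morphism_eq_zero_of_path hd hs fun p => ?_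
      obtain rfl : p = q := Fin.ext (by omega)
      have htop : syzygyTop d i j p = i := if_pos (by omega)
      rw [Function.update_self, hqm, htop]
      omega
    · refine toQuotient_morphism_eq_zero hU hle fun hmem => ?_
      have h1 := (hU' hmem).2
      have hqt : (⊤ : Fin d) = q := Fin.ext (by have := fin_val_top_add_one (d := d); omega)
      have hq0 : (0 : Fin d) ≠ q := fun h => by
        have := congrArg Fin.val h
        rw [Fin.val_zero] at this
        omega
      have htop : syzygyTop d i j 0 = i := if_pos (by rw [Fin.val_zero]; omega)
      rw [hqt, Function.update_self, Function.update_of_ne hq0, hqm, htop] at h1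
      omega

variable (hℓ : IsKupisch ℓ) (hU : ∀ x : Fin d → ℤ, ∀ t : ℤ, x ∉ U → (fun i => x i + t * s) ∉ U)
  (hU' : U ⊆ osCyc d ℓ) (hs : ∀ i t : ℤ, periodicExt ℓ (i + t * s) = periodicExt ℓ i) (i : ℤ)
  {c : Fin d → ℤ} (hi : IsAdmissibleInterval k s U (periodicExt ℓ) (fun _ => i) (fun _ => i))
  (hc : IsAdmissibleInterval k s U (periodicExt ℓ) c c)

include hU hU' hs in
-- Here `m = i`, so the projective cover is the one-vertex module itself, and `d ≥ 1`.
theorem extDim_onePoint_of_eq_one (hi1 : periodicExt ℓ i = 1) :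
    extDim k d (intervalModule hi) (intervalModule hc) = 0 := by
  have h1 : syzygyBot d i i 1 = fun _ => i := funext fun p => by
    simp only [syzygyBot, syzygyTop]
    split_ifs <;> omega
  have hd := Nat.pos_of_ne_zero (NeZero.ne d)
  have := projective_intervalModule hi le_rfl fun q => by
    have h2 := toQuotient_morphism_syzygyTop (k := k) hU hU' hs (i := i) (m := i) (by omega) le_rfl
      hd q
    rwa [zero_add, h1, syzygyTop_zero] at h2
  obtain ⟨e, rfl⟩ := Nat.exists_eq_succ_of_ne_zero (NeZero.ne d)
  exact extDim_succ_eq_zero_of_projective k _ _ e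

include hℓ hU hU' hs in
theorem extDim_onePoint_of_two_le (hi2 : 2 ≤ periodicExt ℓ i)
    (hUi : ∀ x ∈ osCyc d ℓ, x 0 ≤ i → i - periodicExt ℓ i + 1 ≤ x ⊤ → x ∈ U) :
    extDim k d (intervalModule hi) (intervalModule hc) =
      open scoped Classical in if ∃ t : ℤ, c = fun _ => i - 1 + t * s then 1 else 0 := by
  obtain ⟨m, hm⟩ : ∃ m : ℤ, m = i - periodicExt ℓ i + 1 := ⟨_, rfl⟩
  rw [← hm] at hUi
  have hmi : m ≤ i - 1 := by omega
  have hP : ∀ j < d, IsAdmissibleInterval k s U (periodicExt ℓ) (syzygyBot d i m (j + 1))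
    (syzygyTop d i j) := fun j hj => isAdmissibleInterval_syzygy hℓ hm hUi hj
  have hd := Nat.pos_of_ne_zero (NeZero.ne d)
  have hK : ∀ j ≤ d, IsAdmissibleInterval k s U (periodicExt ℓ) (syzygyBot d i m j)
      -- For `j < d` the syzygy `K_j` is a quotient of `P_j`; the last one, `K_d`, is reached as a
      -- submodule of `P_{d-1}`.
      (syzygyTop d i j) := fun j hj => by
    rcases hj.lt_or_eq with hj | rfl
    · exact (hP j hj).mono (syzygyBot_succ_le i hmi j) le_rfl
    · obtain ⟨e, rfl⟩ := Nat.exists_eq_succ_of_ne_zero (NeZero.ne j)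
      exact (hP e (Nat.lt_succ_self e)).mono le_rfl (syzygyTop_succ_le i e)
  have hres := extDim_of_interval_resolution d (syzygyBot d i m) (syzygyTop d i) hK hP
    (fun j _ => syzygyBot_le i hmi j) (fun j _ => syzygyBot_succ_le i hmi j)
    (fun j hj => syzygyTop_succ_lt i hj) (fun j hj x hx => le_syzygyTop_succ_iff i m hj hx)
    (fun j hj => projective_intervalModule (hP j hj)
      ((syzygyBot_succ_le i hmi j).trans (syzygyBot_le i hmi j))
      (toQuotient_morphism_syzygyTop hU hU' hs hm (by omega) hj)) hc d 0 (add_zero d)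
  rw [intervalModule_congr (syzygyBot_zero d i m) (syzygyTop_zero d i) _ hi] at hres
  rw [hres, extDim_zero_eq]
  have hbot : syzygyBot d i m d ≤ syzygyTop d i d := syzygyBot_le i hmi d
  split_ifs with ht
  · rw [rank_hom_onePoint (hK d le_rfl) hbot ((hK d le_rfl).mono hbot le_rfl) hc
      (by rwa [syzygyTop_self]), Cardinal.lift_one]
  · have : Subsingleton (intervalModule (hK d le_rfl) ⟶ intervalModule hc) :=
      subsingleton_of_forall_eq 0 fun φ => eq_zero_of_not_translate (hK d le_rfl) hbot hc
        (by rwa [syzygyTop_self]) φ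
    rw [rank_subsingleton', Cardinal.lift_zero]

end Nakayama

end Resolutions

/-! ### Shifted sequences -/

section Shifts

variable {d : ℕ}

/-- The sequence `(λ_2, …, λ_{d+1}, λ_{d+1})`. -/
def shiftDown (l : Fin (d + 1) → ℤ) : Fin (d + 1) → ℤ :=
  fun p => l ⟨min (p.1 + 1) d, by omega⟩

/-- The sequence `(λ_1, λ_1, …, λ_d)`. -/
def shiftUp (l : Fin (d + 1) → ℤ) : Fin (d + 1) → ℤ :=
  fun p => l ⟨p.1 - 1, by omega⟩

theorem antitone_shiftDown {l : Fin (d + 1) → ℤ} (hl : Antitone l) : Antitone (shiftDown l) :=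
  fun p q hpq => hl (show min (p.1 + 1) d ≤ min (q.1 + 1) d by
    have : p.1 ≤ q.1 := hpq
    omega)

theorem antitone_shiftUp {l : Fin (d + 1) → ℤ} (hl : Antitone l) : Antitone (shiftUp l) :=
  fun p q hpq => hl (show p.1 - 1 ≤ q.1 - 1 by
    have : p.1 ≤ q.1 := hpq
    omega)

/-- The shifted interval has its top at the socle of the given one. Dually, the socle for `shiftUp
l` is the top for `l`, which holds by definition. -/
theorem init_shiftDown (l : Fin (d + 1) → ℤ) : Fin.init (shiftDown l) = Fin.tail l :=
  funext fun p => congrArg l (Fin.ext (min_eq_left p.2))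

theorem shiftDown_zero_le {l : Fin (d + 1) → ℤ} (hl : Antitone l) : shiftDown l 0 ≤ l 0 :=
  hl (Fin.zero_le _)

theorem shiftDown_top (l : Fin (d + 1) → ℤ) : shiftDown l ⊤ = l ⊤ :=
  congrArg l (Fin.ext (min_eq_right (Nat.le_succ d)))

theorem shiftUp_zero (l : Fin (d + 1) → ℤ) : shiftUp l 0 = l 0 :=
  rfl

theorem le_shiftUp_top {l : Fin (d + 1) → ℤ} (hl : Antitone l) : l ⊤ ≤ shiftUp l ⊤ :=
  hl le_top

theorem tail_le_init {l : Fin (d + 1) → ℤ} (hl : Antitone l) : Fin.tail l ≤ Fin.init l :=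
  fun p => hl (Fin.castSucc_le_succ p)

theorem eq_zero_of_tail_eq_init {l : Fin (d + 1) → ℤ} (h : Fin.tail l = Fin.init l)
    (p : Fin (d + 1)) : l p = l 0 := by
  induction p using Fin.induction with
  | zero => rfl
  | succ p ih => exact (congrFun h p).trans ih

end Shifts

/-! ### Classification of the Schur simple objects -/

section Classification

variable {k : Type u} [Field k] {d : ℕ} [NeZero d] {s : ℤ} {U : Set (Fin d → ℤ)} {ℓ : ℤ → ℕ}
  {V : Set (Fin (d + 1) → ℤ)}
  (adm : ∀ l : V, IsAdmissibleInterval k s U ℓ (Fin.tail l.1) (Fin.init l.1))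
  (hV : ∀ l ∈ V, Antitone l) (hdown : ∀ l ∈ V, shiftDown l ∈ V) (hup : ∀ l ∈ V, shiftUp l ∈ V)

include hV hdown hup in
/-- The Schur simple objects among the sums of interval modules are the modules on the vertices
`(i, …, i)`. -/
theorem exists_iso_of_isSchurSimple
    (X : (addHull fun l : V => intervalModule (adm l)).FullSubcategory) (hX : IsSchurSimple X) :
    ∃ (i : ℤ) (hi : (fun _ => i) ∈ V),
      Nonempty (intervalModule (adm ⟨fun _ => i, hi⟩) ≅ X.obj) := by
  obtain ⟨⟨l, hl⟩, ⟨ρ⟩⟩ := exists_retract_of_isSchurSimple k _ X hX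
  have hd := adm ⟨shiftDown l, hdown l hl⟩
  have hu := adm ⟨shiftUp l, hup l hl⟩
  have hP₁ := addHull_apply (fun l : V => intervalModule (adm l)) ⟨shiftDown l, hdown l hl⟩
  have hP₂ := addHull_apply (fun l : V => intervalModule (adm l)) ⟨shiftUp l, hup l hl⟩
  have hd' : IsAdmissibleInterval k s U ℓ (Fin.tail (shiftDown l)) (Fin.tail l) :=
    init_shiftDown l ▸ hd
  have hle₁ := tail_le_init (hV _ (hdown l hl))
  rw [init_shiftDown] at hle₁
  have hP₁' : addHull (fun l : V => intervalModule (adm l)) (intervalModule hd') := by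
    rw [intervalModule_congr rfl (init_shiftDown l).symm hd' hd]
    exact hP₁
  have heq : Fin.tail l = Fin.init l :=
    eq_of_isSchurSimple_retract hX (adm ⟨l, hl⟩) (tail_le_init (hV l hl)) ρ hle₁
      (tail_le_init (hV _ (hup l hl))) hd' hu hP₁' hP₂
  obtain ⟨i, rfl⟩ : ∃ i : ℤ, l = fun _ => i := ⟨l 0, funext (eq_zero_of_tail_eq_init heq)⟩
  refine ⟨i, hl, nonempty_iso_of_retract_onePoint (a := fun _ => i) (fun h0 => hX.1 ?_)
    (adm ⟨fun _ => i, hl⟩) ρ⟩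
  rw [IsZero.iff_id_eq_zero] at h0 ⊢
  ext1
  exact h0

include hV hdown hup in
-- Reduces both types to arithmetic: representatives of the constant sequences modulo `s`, and the
-- dimensions of `Ext^d` between them.
theorem nonempty_quiverIso_of_constants {W : Type*} [Quiver W] (σ : W → ℤ)
    (hσ : ∀ w, (fun _ => σ w) ∈ V)
    (inj : ∀ w w', (∃ t : ℤ, σ w' = σ w + t * s) → w = w')
    (surj : ∀ i : ℤ, (fun _ => i) ∈ V → ∃ w, ∃ t : ℤ, i = σ w + t * s)
    (arrows : ∀ w w', Nonempty ((extDim k d (intervalModule (adm ⟨fun _ => σ w, hσ w⟩))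
      (intervalModule (adm ⟨fun _ => σ w', hσ w'⟩))).out ≃ (w ⟶ w'))) :
    Nonempty (QuiverIso (ExtQuiver k d (addHull fun l : V => intervalModule (adm l))) W) := by
  refine nonempty_quiverIso_of_classification k d _
    (fun w => ⟨_, addHull_apply (fun l : V => intervalModule (adm l)) ⟨fun _ => σ w, hσ w⟩⟩)
    (fun w => isSchurSimple_onePoint (a := fun _ => σ w) (adm ⟨fun _ => σ w, hσ w⟩) _)
    (fun w w' ⟨e⟩ => inj w w' ?_) (fun X hX => ?_) arrows
  · obtain ⟨t, ht⟩ := exists_translate_of_iso (a := fun _ => σ w) (a' := fun _ => σ w')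
      (adm ⟨fun _ => σ w, hσ w⟩) (adm ⟨fun _ => σ w', hσ w'⟩) ((ObjectProperty.ι _).mapIso e)
    exact ⟨t, congrFun ht 0⟩
  · obtain ⟨i, hi, ⟨e⟩⟩ := exists_iso_of_isSchurSimple adm hV hdown hup X hX
    obtain ⟨w, t, ht⟩ := surj i hi
    obtain ⟨e'⟩ := nonempty_iso_onePoint (a := fun _ => σ w) (a' := fun _ => i)
      (adm ⟨fun _ => σ w, hσ w⟩) (adm ⟨fun _ => i, hi⟩) ⟨t, funext fun _ => ht⟩
    exact ⟨w, ⟨ObjectProperty.isoMk _ (e' ≪≫ e)⟩⟩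

theorem nonempty_out_equiv_of_eq_one {c : Cardinal.{u}} (hc : c = 1) {q : Prop} (hq : q) :
    Nonempty (c.out ≃ PLift q) := by
  have h : Cardinal.mk c.out = 1 := by rw [Cardinal.mk_out, hc]
  obtain ⟨h1, h2⟩ := Cardinal.eq_one_iff_unique.1 h
  have : Unique c.out := @Unique.mk' _ ⟨h2.some⟩ h1
  have : Unique (PLift q) := ⟨⟨⟨hq⟩⟩, fun _ => Subsingleton.elim _ _⟩
  exact ⟨Equiv.ofUnique _ _⟩

theorem nonempty_out_equiv_of_eq_zero {c : Cardinal.{u}} (hc : c = 0) {q : Prop} (hq : ¬ q) :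
    Nonempty (c.out ≃ PLift q) := by
  have : IsEmpty c.out := Cardinal.mk_eq_zero_iff.1 (by rw [Cardinal.mk_out, hc])
  have : IsEmpty (PLift q) := ⟨fun h => hq h.down⟩
  exact ⟨Equiv.equivOfIsEmpty _ _⟩

end Classification

/-! ### Kupisch series and the two quivers -/

section Kupisch

theorem add_one_mod_eq_iff {n w w' : ℕ} (hw' : w' < n) :
    (w + 1) % n = w' ↔ ∃ t : ℤ, (n : ℤ) - 1 - w' = n - 1 - w - 1 + t * n := by
  constructor
  · intro h
    refine ⟨((w + 1) / n : ℕ), ?_⟩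
    have h1 := Nat.div_add_mod (w + 1) n
    rw [h] at h1
    have h2 : (n : ℤ) * ((w + 1) / n : ℕ) + w' = w + 1 := by exact_mod_cast h1
    linarith
  · rintro ⟨t, ht⟩
    have h1 : ((w : ℤ) + 1) = w' + t * n := by linarith
    have h2 : ((w : ℤ) + 1) % n = w' := by
      rw [h1, Int.add_mul_emod_self_right]
      exact Int.emod_eq_of_lt (by omega) (by omega)
    exact_mod_cast h2

variable {n : ℕ} [NeZero n] {ℓ : Fin n → ℕ}

theorem periodicExt_add_mul (i t : ℤ) : periodicExt ℓ (i + t * n) = periodicExt ℓ i := by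
  simp only [periodicExt, Int.add_mul_emod_self_right]

theorem periodicExt_zero : periodicExt ℓ 0 = ℓ 0 := by
  simp only [periodicExt]
  congr 1

theorem two_le_periodicExt (hℓ : IsKupisch ℓ) {i : ℤ} (hi : i % n ≠ 0) : 2 ≤ periodicExt ℓ i := by
  have hn : (0 : ℤ) < n := by exact_mod_cast Nat.pos_of_ne_zero (NeZero.ne n)
  refine hℓ.two_le _ fun h => hi ?_
  have h1 := congrArg Fin.val h
  have h2 := Int.emod_nonneg i hn.ne'
  rw [Fin.val_zero] at h1
  simp only at h1
  omega

theorem one_le_periodicExt (hℓ : IsKupisch ℓ) (i : ℤ) : 1 ≤ periodicExt ℓ i := by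
  by_cases h : (⟨(i % n).toNat, by
      have hn : (0 : ℤ) < n := by exact_mod_cast Nat.pos_of_ne_zero (NeZero.ne n)
      have := Int.emod_nonneg i hn.ne'
      have := Int.emod_lt_of_pos i hn
      omega⟩ : Fin n) = 0
  · rw [periodicExt, h]
    exact hℓ.pos
  · exact one_le_two.trans (hℓ.two_le _ h)

theorem two_le_periodicExt_of_ne_one (hℓ : IsKupisch ℓ) (h0 : ℓ 0 ≠ 1) (i : ℤ) :
    2 ≤ periodicExt ℓ i := by
  by_cases hi : i % n = 0
  · have h1 : periodicExt ℓ i = ℓ 0 := by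
      rw [← periodicExt_zero (ℓ := ℓ)]
      simp only [periodicExt, hi, Int.zero_emod]
    have := hℓ.pos
    omega
  · exact two_le_periodicExt hℓ hi

/-- The first entry may drop while the last is kept; the bound survives because `i - ℓ_i` is weakly
increasing, which is the Kupisch condition. -/
theorem shiftDown_bound {d : ℕ} (hℓ : IsKupisch ℓ) {l : Fin (d + 1) → ℤ} (hl : Antitone l)
    (h : l 0 - l ⊤ + 1 ≤ periodicExt ℓ (l 0)) :
    shiftDown l 0 - shiftDown l ⊤ + 1 ≤ periodicExt ℓ (shiftDown l 0) := by
  have h1 := sub_periodicExt_mono hℓ (shiftDown_zero_le hl)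
  simp only at h1
  rw [shiftDown_top]
  omega

theorem shiftUp_bound {d : ℕ} {l : Fin (d + 1) → ℤ} (hl : Antitone l)
    (h : l 0 - l ⊤ + 1 ≤ periodicExt ℓ (l 0)) :
    shiftUp l 0 - shiftUp l ⊤ + 1 ≤ periodicExt ℓ (shiftUp l 0) := by
  have h1 := le_shiftUp_top hl
  rw [shiftUp_zero]
  omega

variable (k : Type u) [Field k] (d : ℕ) [NeZero d]

theorem nonempty_quiverIso_linear (hℓ : IsKupisch ℓ) (h0 : ℓ 0 = 1) :
    Nonempty (QuiverIso (ExtQuiver k d (linClusterTilting k d hℓ)) (LinearQuiver n)) := by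
  have hn : (0 : ℤ) < n := by exact_mod_cast Nat.pos_of_ne_zero (NeZero.ne n)
  have hU : ∀ x : Fin d → ℤ, ∀ t : ℤ, x ∉ osLin d ℓ → (fun i => x i + t * 0) ∉ osLin d ℓ := by
    intro x t hx
    simpa only [mul_zero, add_zero] using hx
  have hU' : osLin d ℓ ⊆ osCyc d ℓ := fun x hx => ⟨hx.1, hx.2.2.2⟩
  have hs : ∀ i t : ℤ, periodicExt ℓ (i + t * 0) = periodicExt ℓ i := fun i t => by
    rw [mul_zero, add_zero]
  -- `Ext^d` leads from `i` to `i - 1`, whereas the arrows of the quiver raise the index; hence the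
  -- reversed numbering.
  let σ : LinearQuiver n → ℤ := fun w => n - 1 - (w : Fin n).1
  have hσ : ∀ w, 0 ≤ σ w ∧ σ w ≤ n - 1 := fun w => by
    have := (w : Fin n).2
    constructor <;> simp only [σ] <;> omega
  refine nonempty_quiverIso_of_constants (V := osLin (d + 1) ℓ) _ (fun l hl => hl.1)
    (fun l hl => ⟨antitone_shiftDown hl.1, (shiftDown_zero_le hl.1).trans hl.2.1,
      hl.2.2.1.trans (shiftDown_top l).ge, shiftDown_bound hℓ hl.1 hl.2.2.2⟩)
    (fun l hl => ⟨antitone_shiftUp hl.1, hl.2.1, hl.2.2.1.trans (le_shiftUp_top hl.1),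
      shiftUp_bound hl.1 hl.2.2.2⟩)
    σ (fun w => ⟨antitone_const, (hσ w).2, (hσ w).1, ?_⟩) ?_ ?_ ?_
  · have := one_le_periodicExt hℓ (σ w)
    simp only
    omega
  · rintro w w' ⟨t, ht⟩
    refine Fin.ext ?_
    simp only [σ] at ht
    omega
  · intro i hi
    have h1 : i ≤ n - 1 := hi.2.1
    have h2 : 0 ≤ i := hi.2.2.1
    refine ⟨(⟨(n - 1 - i).toNat, by omega⟩ : Fin n), 0, ?_⟩
    simp only [σ]
    omega
  · intro w w'
    by_cases hw : σ w = 0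
    · refine nonempty_out_equiv_of_eq_zero (extDim_onePoint_of_eq_one hU hU' hs (σ w)
        (c := fun _ => σ w') _ _ (by rw [hw, periodicExt_zero, h0])) ?_
      have := (w' : Fin n).2
      simp only [σ] at hw
      intro h
      omega
    · have hmod : σ w % n = σ w := Int.emod_eq_of_lt (hσ w).1 (by linarith [(hσ w).2])
      have hext := fun hi hc => extDim_onePoint_of_two_le (k := k) hℓ hU hU' hs (σ w)
        (c := fun _ => σ w') hi hc (two_le_periodicExt hℓ (by rwa [hmod]))
        fun x hx h1 h2 => ⟨hx.1, h1.trans (hσ w).2, by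
          -- Comparison with `0`, where `ℓ_0 = 1`, gives `i - ℓ_i ≥ -1`; so the resolution stays
          -- among sequences with non-negative entries.
          have h3 := sub_periodicExt_mono hℓ (hσ w).1
          simp only [periodicExt_zero, h0] at h3
          push_cast at h3
          linarith, hx.2⟩
      by_cases hww : (w : Fin n).1 + 1 = (w' : Fin n).1
      · refine nonempty_out_equiv_of_eq_one ((hext _ _).trans (if_pos ⟨0, funext fun _ => ?_⟩)) hww
        simp only [σ]
        omega
      · refine nonempty_out_equiv_of_eq_zero ((hext _ _).trans (if_neg ?_)) hww
        rintro ⟨t, ht⟩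
        have ht' := congrFun ht 0
        simp only [σ] at ht'
        omega

theorem nonempty_quiverIso_cyclic (hℓ : IsKupisch ℓ) (h0 : ℓ 0 ≠ 1) :
    Nonempty (QuiverIso (ExtQuiver k d (cycClusterTilting k d hℓ)) (CyclicQuiver n)) := by
  have hn : (0 : ℤ) < n := by exact_mod_cast Nat.pos_of_ne_zero (NeZero.ne n)
  have hU : ∀ x : Fin d → ℤ, ∀ t : ℤ, x ∉ osCyc d ℓ → (fun i => x i + t * n) ∉ osCyc d ℓ := by
    refine fun x t hx hx' => hx ⟨fun p q hpq => ?_, ?_⟩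
    · have := hx'.1 hpq
      simp only at this
      linarith
    · have := hx'.2
      rw [periodicExt_add_mul] at this
      linarith
  have hs : ∀ i t : ℤ, periodicExt ℓ (i + t * n) = periodicExt ℓ i := periodicExt_add_mul
  let σ : CyclicQuiver n → ℤ := fun w => n - 1 - (w : Fin n).1
  refine nonempty_quiverIso_of_constants (V := osCyc (d + 1) ℓ) _ (fun l hl => hl.1)
    (fun l hl => ⟨antitone_shiftDown hl.1, shiftDown_bound hℓ hl.1 hl.2⟩)
    (fun l hl => ⟨antitone_shiftUp hl.1, shiftUp_bound hl.1 hl.2⟩)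
    σ (fun w => ⟨antitone_const, ?_⟩) ?_ ?_ ?_
  · have := one_le_periodicExt hℓ (σ w)
    simp only
    omega
  · rintro w w' ⟨t, ht⟩
    have h1 := (w : Fin n).2
    have h2 := (w' : Fin n).2
    refine Fin.ext ?_
    simp only [σ] at ht
    have h3 : ((w : Fin n).1 : ℤ) = (w' : Fin n).1 + t * n := by linarith
    have h4 := congrArg (· % (n : ℤ)) h3
    simp only [Int.add_mul_emod_self_right] at h4
    rw [Int.emod_eq_of_lt (by omega) (by omega), Int.emod_eq_of_lt (by omega) (by omega)] at h4
    exact_mod_cast h4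
  · intro i _
    have h1 := Int.emod_nonneg i hn.ne'
    have h2 := Int.emod_lt_of_pos i hn
    have h3 := Int.mul_ediv_add_emod i n
    refine ⟨(⟨(n - 1 - i % n).toNat, by omega⟩ : Fin n), i / n, ?_⟩
    simp only [σ]
    rw [Int.toNat_of_nonneg (by omega)]
    linarith
  · intro w w'
    have hext := fun hi hc => extDim_onePoint_of_two_le (k := k) hℓ hU subset_rfl hs (σ w)
      (c := fun _ => σ w') hi hc (two_le_periodicExt_of_ne_one hℓ h0 _) fun x hx _ _ => hx
    have hiff := add_one_mod_eq_iff (n := n) (w := (w : Fin n).1) (w' : Fin n).2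
    by_cases hww : ((w : Fin n).1 + 1) % n = (w' : Fin n).1
    · obtain ⟨t, ht⟩ := hiff.1 hww
      exact nonempty_out_equiv_of_eq_one ((hext _ _).trans (if_pos ⟨t, funext fun _ => ht⟩)) hww
    · refine nonempty_out_equiv_of_eq_zero ((hext _ _).trans (if_neg ?_)) hww
      rintro ⟨t, ht⟩
      exact hww (hiff.2 ⟨t, congrFun ht 0⟩)

end Kupisch

end

end HigherNakayama


theorem mainTheorem2 (k : Type*) [Field k] (d n : ℕ) [NeZero d] [NeZero n]
    (ℓ : Fin n → ℕ) (hℓ : HigherNakayama.IsKupisch ℓ) :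
    (ℓ 0 = 1 →
      Nonempty (HigherNakayama.QuiverIso
        (HigherNakayama.ExtQuiver k d (HigherNakayama.linClusterTilting k d hℓ))
        (HigherNakayama.LinearQuiver n))) ∧
    (ℓ 0 ≠ 1 →
      Nonempty (HigherNakayama.QuiverIso
        (HigherNakayama.ExtQuiver k d (HigherNakayama.cycClusterTilting k d hℓ))
        (HigherNakayama.CyclicQuiver n))) :=
  ⟨HigherNakayama.nonempty_quiverIso_linear k d hℓ, HigherNakayama.nonempty_quiverIso_cyclic k d hℓ⟩
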